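/- **Setting.** A *biquandle* is a set $X$ with two binary operations $\underline{*},\overline{*}$ such that: $x\,\underline{*}\,x=x\,\overline{*}\,x$; for each $x$ the maps $\bullet\,\underline{*}\,x$ and $\bullet\,\overline{*}\,x$ are bijective, and $(x,y)\mapsto(y\,\overline{*}\,x,\;x\,\underline{*}\,y)$ is a bijection of $X\times X$; and $(x\underline{*}y)\underline{*}(z\underline{*}y)=(x\underline{*}z)\underline{*}(y\overline{*}z)$, $(x\overline{*}y)\overline{*}(z\overline{*}y)=(x\overline{*}z)\overline{*}(y\underline{*}z)$, $(x\underline{*}y)\overline{*}(z\underline{*}y)=(x\overline{*}z)\underline{*}(y\overline{*}z)$. A quandle $(Q,*)$ is regarded as a biquandle with $x\,\underline{*}\,y=x*y$, $x\,\overline{*}\,y=x$. The quandle $\mathcal Q(X)$ is the set $X$ with $x*y=(x\,\underline{*}\,y)\,\overline{*}^{-1}y$. The group $\mathrm{As}(X)$ has generators $x\in X$ and relations $x\cdot(y\,\overline{*}\,x)=y\cdot(x\,\underline{*}\,y)$. Let $k:X\to X$ be the bijection with $k(x)\,\overline{*}\,k(x)=x$, and let $\psi:\mathrm{As}(\mathcal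 Q(X))\times\mathcal Q(X)\to X$ be the map with $\psi(e,a)=a$, $\psi(p\cdot b,a)=\psi(p,a)\,\overline{*}\,\psi(p,b)$, $\psi(p\cdot b^{-1},a)=\psi(p,a)\,\overline{*}^{-1}k(\psi(p,b))$. Let $A$ be an abelian group. A *biquandle 2-cocycle* is a map $\theta:X\times X\to A$ with $\theta(y,y)=0$ and $$\theta(x_2,x_3)-\theta(x_2\overline{*}x_1,x_3\overline{*}x_1)-\theta(x_1,x_3)+\theta(x_1\underline{*}x_2,x_3\overline{*}x_2)+\theta(x_1,x_2)-\theta(x_1\underline{*}x_3,x_2\underline{*}x_3)=0 .$$ A *shadow quandle 2-cocycle* on a quandle $Q$ is a map $\theta:\mathrm{As}(Q)\times Q\times Q\to A$ with $\theta(p,b,b)=0$ and $$\theta(p,a_2,a_3)-\theta(pa_1,a_2,a_3)-\theta(p,a_1,a_3)+\theta(pa_2,a_1*a_2,a_3)+\theta(p,a_1,a_2)-\theta(pa_3,a_1*a_3,a_2*a_3)=0 .$$ Let $D$ be a planar diagram of an oriented link, taken up to isotopy of the plane, so that it may be put in general position with respect to the height function and cut into horizontal slices each containing one maximum, one minimum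 or one crossing, separated by rows of vertical strings. Strings have normal vectors obtained by rotating the orientation counterclockwise by a right angle. At each crossing there is exactly one adjacent region, the *specified region*, from which the normals of both strings point away. Let $\sigma_i,\sigma_k$ be the two under semi-arcs and $\sigma_j,\sigma_l$ the two over semi-arcs at the crossing, with $\sigma_i,\sigma_j$ bounding the specified region. A biquandle coloring is a map $\mathcal C$ from the semi-arcs to $X$ with $\mathcal C(\sigma_i)\,\underline{*}\,\mathcal C(\sigma_j)=\mathcal C(\sigma_k)$ and $\mathcal C(\sigma_j)\,\overline{*}\,\mathcal C(\sigma_i)=\mathcal C(\sigma_l)$ at every crossing; a quandle coloring is a map $\mathcal C$ from the arcs to $Q$ with $\mathcal C(\sigma_i)*\mathcal C(\sigma_j)=\mathcal C(\sigma_k)$ at every crossing. The sets of colorings are $\mathrm{Col}_X(D)$ and $\mathrm{Col}_Q(D)$. The region coloring $\mathcal C^R$ of a coloring is the unique map from the regions to the associated group that is $e$ on the unbounded region and satisfies $\mathcal C^R(R_1)\cdot\mathcal C(\sigma)=\mathcal C^R(R_2)$ whenever the normal of $\sigma$ points from $R_1$ to $R_2$. A crossing with sign $\epsilon$ and specified region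 $R$ has weight $\epsilon\,\theta(\mathcal C(\sigma_i),\mathcal C(\sigma_j))$ for a biquandle 2-cocycle $\theta$ and $\mathcal C\in\mathrm{Col}_X(D)$, and weight $\epsilon\,\theta(\mathcal C^R(R),\mathcal C(\sigma_i),\mathcal C(\sigma_j))$ for a shadow quandle 2-cocycle $\theta$ and $\mathcal C\in\mathrm{Col}_Q(D)$. The sums of the weights over all crossings are the invariants $(\Phi_\theta(D))(\mathcal C)$ and $(\Phi^S_\theta(D))(\mathcal C)$. If $X$ (resp. $Q$) is finite, $\Phi_\theta(D)$ (resp. $\Phi^S_\theta(D)$) also denotes the sum in $\mathbb Z[A]$, over all colorings, of the basis elements given by these values. For $\mathcal C\in\mathrm{Col}_{\mathcal Q(X)}(D)$, put behind every string of $D$ a copy with the opposite orientation, pushed slightly in the normal direction, and give each string and its copy in each row of vertical strings the color that $\mathcal C$ gives to the arc. In each row pull the copies away to the right, behind all other strings they meet: first the copy of the leftmost string to the far right, then the copy of the second string to the left of that one, and so on. Extending the biquandle coloring through these crossings leaves colors in $X$ on the strings of $D$. Write $\Psi(\mathcal C)$ for the resulting assignment of colors. **Theorem.** Let $X$ be a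 biquandle, $A$ an abelian group and $\theta:X\times X\to A$ a biquandle 2-cocycle. Then $(\psi^*\theta)(p,a,b):=\theta(\psi(p,a),\psi(p,b))$ is a shadow quandle 2-cocycle on $\mathcal Q(X)$. For every diagram $D$ of an oriented link, $\Psi$ is a well-defined bijection $\mathrm{Col}_{\mathcal Q(X)}(D)\to\mathrm{Col}_X(D)$, and for every $\mathcal C\in\mathrm{Col}_{\mathcal Q(X)}(D)$ the weight of each crossing with respect to $\Psi(\mathcal C)$ and $\theta$ equals its weight with respect to $\mathcal C$ and $\psi^*\theta$; hence $(\Phi_\theta(D))(\Psi(\mathcal C))=(\Phi^S_{\psi^*\theta}(D))(\mathcal C)$. In particular, if $X$ is finite, $\Phi_\theta(D)=\Phi^S_{\psi^*\theta}(D)$ in $\mathbb Z[A]$. -/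

import Mathlib

open Function

namespace BiquandleLink

universe u v

/-! ### Biquandles -/

/-- A biquandle. Here `underOp x y` is the underlined product of `x` and `y` and `overOp x y` is the
overlined product of `x` and `y`. -/
class Biquandle (X : Type u) where
  underOp : X → X → X
  overOp : X → X → X
  under_self : ∀ x, underOp x x = overOp x x
  under_bijective : ∀ x, Bijective fun z => underOp z x
  over_bijective : ∀ x, Bijective fun z => overOp z x
  switch_bijective : Bijective fun p : X × X => (overOp p.2 p.1, underOp p.1 p.2)
  under_under : ∀ x y z,
    underOp (underOp x y) (underOp z y) = underOp (underOp x z) (overOp y z)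
  over_over : ∀ x y z,
    overOp (overOp x y) (overOp z y) = overOp (overOp x z) (underOp y z)
  under_over : ∀ x y z,
    overOp (underOp x y) (underOp z y) = underOp (overOp x z) (overOp y z)

open Biquandle

section Basic

variable {X : Type u} [Biquandle X]

/-- The permutation `z ↦ overOp z x`. -/
noncomputable def overPerm (x : X) : Equiv.Perm X := Equiv.ofBijective _ (over_bijective x)

/-- The inverse operation: `overInv z x` is the unique `w` with `overOp w x = z`. -/
noncomputable def overInv (z x : X) : X := (overPerm x).symm z

/-- The permutation `z ↦ underOp z x`. -/
noncomputable def underPerm (x : X) : Equiv.Perm X := Equiv.ofBijective _ (under_bijective x)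

/-- The inverse operation: `underInv z x` is the unique `w` with `underOp w x = z`. -/
noncomputable def underInv (z x : X) : X := (underPerm x).symm z

theorem over_overInv (z x : X) : overOp (overInv z x) x = z :=
  (overPerm x).apply_symm_apply z

theorem overInv_over (z x : X) : overInv (overOp z x) x = z :=
  (overPerm x).symm_apply_apply z

theorem under_underInv (z x : X) : underOp (underInv z x) x = z :=
  (underPerm x).apply_symm_apply z

theorem underInv_under (z x : X) : underInv (underOp z x) x = z :=
  (underPerm x).symm_apply_apply z

theorem over_right_cancel {x y z : X} (h : overOp x z = overOp y z) : x = y :=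
  (over_bijective z).1 h

theorem over_self_bijective : Bijective fun x : X => overOp x x := by
  constructor
  · intro x y h
    have h' : overOp x x = overOp y y := h
    have : (x, x) = (y, y) := switch_bijective.1 (by
      show (overOp x x, underOp x x) = (overOp y y, underOp y y)
      rw [under_self, under_self, h'])
    exact congrArg Prod.fst this
  · intro z
    obtain ⟨⟨x, y⟩, h⟩ := (switch_bijective (X := X)).2 (z, z)
    have h1 : overOp y x = z := congrArg Prod.fst h
    have h2 : underOp x y = z := congrArg Prod.snd h
    have h3 := over_over y x y
    rw [h2, h1] at h3
    have h4 : overOp y y = z := (over_right_cancel h3).symm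
    exact ⟨y, h4⟩

/-- The bijection `k : X → X` with `overOp (k x) (k x) = x`. -/
noncomputable def kMap : Equiv.Perm X := (Equiv.ofBijective _ (over_self_bijective (X := X))).symm

theorem over_kMap (x : X) : overOp (kMap x) (kMap x) = x :=
  (Equiv.ofBijective _ (over_self_bijective (X := X))).apply_symm_apply x

theorem kMap_over (x : X) : kMap (overOp x x) = x :=
  (Equiv.ofBijective _ (over_self_bijective (X := X))).symm_apply_apply x

/-- The derived operation on a biquandle. -/
noncomputable def derived (x y : X) : X := overInv (underOp x y) y

theorem over_derived (x y : X) : overOp (derived x y) y = underOp x y := over_overInv _ _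

theorem derived_over (x y c : X) : derived (overOp x c) (overOp y c) = overOp (derived x y) c := by
  apply over_right_cancel (z := overOp y c)
  rw [over_derived, over_over, over_derived, under_over]

theorem derived_under (x y c : X) : derived (underOp x c) (underOp y c) = underOp (derived x y) c := by
  apply over_right_cancel (z := underOp y c)
  rw [over_derived, under_under, under_over, over_derived]

theorem derived_derived (x y c : X) :
    derived (derived x y) c = derived (derived x c) (derived y c) := by
  apply over_right_cancel (z := c)
  rw [over_derived, ← derived_over, over_derived, over_derived, derived_under]

theorem derived_self (x : X) : derived x x = x := by
  rw [derived, under_self, overInv_over]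

end Basic

/-- The quandle `Q(X)` associated with a biquandle `X`. Its underlying set is a copy of `X`, with
`Qdl.of : X → Qdl X` and `Qdl.val : Qdl X → X` the identity maps. -/
@[ext] structure Qdl (X : Type u) where of ::
  val : X

instance (X : Type u) [Finite X] : Finite (Qdl X) :=
  Finite.of_injective Qdl.val fun _ _ => Qdl.ext

/-- The product of `a` and `b` in `Q(X)` is `derived a b`. Mathlib writes the quandle operation on
the other side: the product of `a` and `b`, in the convention in which `b` acts from the right, is
`Shelf.act b a`. -/
noncomputable instance (X : Type u) [Biquandle X] : Quandle (Qdl X) where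
  act b a := ⟨derived a.val b.val⟩
  self_distrib := Qdl.ext (derived_derived _ _ _)
  invAct b a := ⟨underInv (overOp a.val b.val) b.val⟩
  left_inv b a := Qdl.ext (by
    show underInv (overOp (derived a.val b.val) b.val) b.val = a.val
    rw [over_derived, underInv_under])
  right_inv b a := Qdl.ext (by
    show overInv (underOp (underInv (overOp a.val b.val) b.val) b.val) b.val = a.val
    rw [under_underInv, overInv_over])
  fix := Qdl.ext (derived_self _)

/-- A quandle is a biquandle whose overlined product is trivial. -/
instance Quandle.toBiquandle (Q : Type u) [Quandle Q] : Biquandle Q where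
  underOp x y := Shelf.act y x
  overOp x _ := x
  under_self x := Quandle.fix
  under_bijective x := ⟨(Rack.left_inv x).injective, (Rack.right_inv x).surjective⟩
  over_bijective _ := bijective_id
  switch_bijective := by
    constructor
    · rintro ⟨x, y⟩ ⟨x', y'⟩ h
      obtain ⟨h1, h2⟩ := Prod.mk.inj h
      simp only at h1 h2
      subst h1
      rw [(Rack.left_inv y).injective h2]
    · rintro ⟨y, w⟩
      exact ⟨(Rack.invAct y w, y), Prod.ext rfl (Rack.right_inv y w)⟩
  under_under _ _ _ := Shelf.self_distrib.symm
  over_over _ _ _ := rfl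
  under_over _ _ _ := rfl

/-! ### The associated group and the map `ψ` -/

/-- The relators of the associated group. -/
def assocRels (X : Type u) [Biquandle X] : Set (FreeGroup X) :=
  {r | ∃ x y : X, r = (FreeGroup.of x * FreeGroup.of (overOp y x)) *
    (FreeGroup.of y * FreeGroup.of (underOp x y))⁻¹}

/-- The associated group `As(X)` of a biquandle (hence also of a quandle). -/
abbrev As (X : Type u) [Biquandle X] : Type u := PresentedGroup (assocRels X)

/-- The generator of `As(X)` given by an element of `X`. -/
def gen {X : Type u} [Biquandle X] (x : X) : As X := PresentedGroup.of x

theorem gen_mul_gen {X : Type u} [Biquandle X] (x y : X) :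
    gen x * gen (overOp y x) = gen y * gen (underOp x y) := by
  have h : (PresentedGroup.mk (assocRels X)) ((FreeGroup.of x * FreeGroup.of (overOp y x)) *
      (FreeGroup.of y * FreeGroup.of (underOp x y))⁻¹) = 1 :=
    PresentedGroup.one_of_mem ⟨x, y, rfl⟩
  rw [map_mul, map_inv, mul_inv_eq_one, map_mul, map_mul] at h
  exact h

section Psi

variable {X : Type u} [Biquandle X]

variable (X) in
/-- The endomorphisms of `Q(X)`, as maps `X → X`. -/
abbrev DerivedEnd : Type u := {f : X → X // ∀ x y, f (derived x y) = derived (f x) (f y)}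

theorem derived_overInv (x y c : X) :
    derived (overInv x c) (overInv y c) = overInv (derived x y) c := by
  apply over_right_cancel (z := c)
  rw [← derived_over, over_overInv, over_overInv, over_overInv]

/-- The permutation `f ↦ (a ↦ overOp (f a) (f b))` of the endomorphisms of `Q(X)`; its inverse is
`f ↦ (a ↦ overInv (f a) (k (f b)))`. -/
noncomputable def psiStep (b : X) : Equiv.Perm (DerivedEnd X) where
  toFun f := ⟨fun a => overOp (f.1 a) (f.1 b), fun x y => by beta_reduce; rw [f.2, derived_over]⟩
  invFun f := ⟨fun a => overInv (f.1 a) (kMap (f.1 b)), fun x y => by beta_reduce; rw [f.2, derived_overInv]⟩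
  left_inv f := by
    apply Subtype.ext
    funext a
    simp only [kMap_over, overInv_over]
  right_inv f := by
    apply Subtype.ext
    funext a
    have : overInv (f.1 b) (kMap (f.1 b)) = kMap (f.1 b) :=
      over_right_cancel ((over_overInv _ _).trans (over_kMap _).symm)
    simp only [this, over_overInv]

/-- The right action of `As(Q(X))` on the endomorphisms of `Q(X)` in which `b` acts by
`psiStep b`. -/
noncomputable def psiHom : As (Qdl X) →* (Equiv.Perm (DerivedEnd X))ᵐᵒᵖ :=
  PresentedGroup.toGroup (f := fun b : Qdl X => MulOpposite.op (psiStep b.val)) (by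
    rintro r ⟨x, y, rfl⟩
    rw [map_mul, map_inv, mul_inv_eq_one, map_mul, map_mul]
    simp only [FreeGroup.lift_apply_of]
    rw [← MulOpposite.op_mul, ← MulOpposite.op_mul]
    congr 1
    apply Equiv.ext
    intro f
    apply Subtype.ext
    funext a
    show overOp (overOp (f.1 a) (f.1 x.val)) (overOp (f.1 y.val) (f.1 x.val)) =
      overOp (overOp (f.1 a) (f.1 y.val)) (overOp (f.1 (derived x.val y.val)) (f.1 y.val))
    rw [f.2, over_derived, over_over])

/-- The map `ψ : As(Q(X)) × Q(X) → X`; its inductive description is `psi_one`, `psi_mul_gen` and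
`psi_mul_gen_inv`. -/
noncomputable def psi (p : As (Qdl X)) (a : Qdl X) : X :=
  ((psiHom p).unop ⟨id, fun _ _ => rfl⟩).1 a.val

theorem psiHom_gen (b : Qdl X) : psiHom (gen b) = MulOpposite.op (psiStep b.val) :=
  PresentedGroup.toGroup.of _

theorem psi_one (a : Qdl X) : psi 1 a = a.val := by
  simp only [psi, map_one]
  rfl

theorem psi_mul_gen (p : As (Qdl X)) (a b : Qdl X) :
    psi (p * gen b) a = overOp (psi p a) (psi p b) := by
  simp only [psi, map_mul, psiHom_gen]
  rfl

theorem psi_mul_gen_inv (p : As (Qdl X)) (a b : Qdl X) :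
    psi (p * (gen b)⁻¹) a = overInv (psi p a) (kMap (psi p b)) := by
  simp only [psi, map_mul, map_inv, psiHom_gen]
  rfl

end Psi

/-! ### Cocycles -/

section Cocycles

variable {A : Type v} [AddCommGroup A]

/-- Biquandle 2-cocycles. -/
structure IsBiquandleCocycle {X : Type u} [Biquandle X] (θ : X × X → A) : Prop where
  cocycle : ∀ x₁ x₂ x₃ : X,
    (θ (x₂, x₃) - θ (overOp x₂ x₁, overOp x₃ x₁))
      - (θ (x₁, x₃) - θ (underOp x₁ x₂, overOp x₃ x₂))
      + (θ (x₁, x₂) - θ (underOp x₁ x₃, underOp x₂ x₃)) = 0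
  degenerate : ∀ y : X, θ (y, y) = 0

/-- Shadow quandle 2-cocycles; `Shelf.act b a` is the product of `a` and `b` in the quandle. -/
structure IsShadowCocycle {Q : Type u} [Quandle Q] (θ : As Q × Q × Q → A) : Prop where
  cocycle : ∀ (p : As Q) (a₁ a₂ a₃ : Q),
    (θ (p, a₂, a₃) - θ (p * gen a₁, a₂, a₃))
      - (θ (p, a₁, a₃) - θ (p * gen a₂, Shelf.act a₂ a₁, a₃))
      + (θ (p, a₁, a₂) - θ (p * gen a₃, Shelf.act a₃ a₁, Shelf.act a₃ a₂)) = 0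
  degenerate : ∀ (p : As Q) (b : Q), θ (p, b, b) = 0

/-- The pullback of `θ` by `ψ`. -/
noncomputable def pullback {X : Type u} [Biquandle X] (θ : X × X → A) :
    As (Qdl X) × Qdl X × Qdl X → A :=
  fun t => θ (psi t.1 t.2.1, psi t.1 t.2.2)

end Cocycles

/-! ### Oriented link diagrams

A diagram in the plane is put in general position with respect to the height function and cut into
horizontal slices, each of which holds one maximum, one minimum or one crossing. Between two
consecutive slices the diagram is a row of vertical strings, recorded from left to right by their
orientations: `true` for a string oriented downward and `false` for one oriented upward. -/

/-- The type of a slice. In `cross leftOver` the two strings starting at the upper left and the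
upper right cross, and `leftOver` says that the one from the upper left to the lower right is the
over-string. -/
inductive SliceKind
  | max
  | min
  | cross (leftOver : Bool)
  deriving DecidableEq

/-- A slice: its type and the number of strings to the left of the event. -/
structure Slice where
  kind : SliceKind
  pos : ℕ

/-- `s.Fits t b`: the slice `s` has the row `t` at its top and the row `b` at its bottom. -/
def Slice.Fits (s : Slice) (t b : List Bool) : Prop :=
  ∃ l r : List Bool, l.length = s.pos ∧
    match s.kind with
    | .max => ∃ ε, t = l ++ r ∧ b = l ++ ε :: (!ε) :: r
    | .min => ∃ ε, t = l ++ ε :: (!ε) :: r ∧ b = l ++ r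
    | .cross _ => ∃ ε δ, t = l ++ ε :: δ :: r ∧ b = l ++ δ :: ε :: r

/-- An oriented link diagram in the plane, read from top to bottom. -/
structure LinkDiagram where
  /-- the number of slices -/
  len : ℕ
  slice : Fin len → Slice
  /-- the rows of vertical strings above, between and below the slices -/
  row : Fin (len + 1) → List Bool
  fits : ∀ k : Fin len, (slice k).Fits (row k.castSucc) (row k.succ)
  row_zero : row 0 = []
  row_last : row (Fin.last len) = []

/-- String number `i` of the upper row is string number `j` of the lower row, and is not involved
in the event of the slice. -/
def Slice.StringPass (s : Slice) (i j : ℕ) : Prop :=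
  match s.kind with
  | .max => (i < s.pos ∧ j = i) ∨ (s.pos ≤ i ∧ j = i + 2)
  | .min => (i < s.pos ∧ j = i) ∨ (s.pos ≤ j ∧ i = j + 2)
  | .cross _ => (i < s.pos ∨ s.pos + 2 ≤ i) ∧ j = i

/-- Gap number `g` of the upper row and gap number `h` of the lower row are in the same component
of the complement of the slice. Gap number `g` has `g` strings on its left. -/
def Slice.GapPass (s : Slice) (g h : ℕ) : Prop :=
  match s.kind with
  | .max => (g ≤ s.pos ∧ h = g) ∨ (s.pos ≤ g ∧ h = g + 2)
  | .min => (g ≤ s.pos ∧ h = g) ∨ (s.pos ≤ h ∧ g = h + 2)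
  | .cross _ => g ≠ s.pos + 1 ∧ h = g

namespace LinkDiagram

variable (D : LinkDiagram)

/-- The pieces (vertical strings) of the curves of the diagram. -/
abbrev Piece : Type := Σ k : Fin (D.len + 1), Fin (D.row k).length

/-- The orientation of a piece: `true` if it is oriented downward. -/
def down (s : D.Piece) : Bool := (D.row s.1)[s.2]

/-- Two pieces that are connected within a slice without going through the crossing. -/
inductive Joined : D.Piece → D.Piece → Prop
  | pass (k : Fin D.len) (i : Fin (D.row k.castSucc).length) (j : Fin (D.row k.succ).length)
      (h : (D.slice k).StringPass i j) : Joined ⟨k.castSucc, i⟩ ⟨k.succ, j⟩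
  | max (k : Fin D.len) (i j : Fin (D.row k.succ).length) (h : (D.slice k).kind = .max)
      (hi : (i : ℕ) = (D.slice k).pos) (hj : (j : ℕ) = (D.slice k).pos + 1) :
      Joined ⟨k.succ, i⟩ ⟨k.succ, j⟩
  | min (k : Fin D.len) (i j : Fin (D.row k.castSucc).length) (h : (D.slice k).kind = .min)
      (hi : (i : ℕ) = (D.slice k).pos) (hj : (j : ℕ) = (D.slice k).pos + 1) :
      Joined ⟨k.castSucc, i⟩ ⟨k.castSucc, j⟩

/-- Two pieces that are connected within a slice, possibly by the over-string of a crossing. -/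
inductive OverJoined : D.Piece → D.Piece → Prop
  | joined {s t : D.Piece} (h : D.Joined s t) : OverJoined s t
  | leftOver (k : Fin D.len) (i : Fin (D.row k.castSucc).length) (j : Fin (D.row k.succ).length)
      (h : (D.slice k).kind = .cross true)
      (hi : (i : ℕ) = (D.slice k).pos) (hj : (j : ℕ) = (D.slice k).pos + 1) :
      OverJoined ⟨k.castSucc, i⟩ ⟨k.succ, j⟩
  | rightOver (k : Fin D.len) (i : Fin (D.row k.castSucc).length) (j : Fin (D.row k.succ).length)
      (h : (D.slice k).kind = .cross false)
      (hi : (i : ℕ) = (D.slice k).pos + 1) (hj : (j : ℕ) = (D.slice k).pos) :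
      OverJoined ⟨k.castSucc, i⟩ ⟨k.succ, j⟩

/-- The set of semi-arcs of the diagram. -/
def SemiArc : Type := Quot D.Joined

/-- The set of arcs of the diagram. -/
def Arc : Type := Quot D.OverJoined

/-- The semi-arc that contains a piece. -/
def semiArc (s : D.Piece) : D.SemiArc := Quot.mk _ s

/-- The natural surjection from the semi-arcs to the arcs. -/
def toArc : D.SemiArc → D.Arc :=
  Quot.lift (fun s => Quot.mk _ s) fun _ _ h => Quot.sound (.joined h)

/-- The pieces (gaps of the rows) of the complement of the diagram. -/
abbrev Gap : Type := Σ k : Fin (D.len + 1), Fin ((D.row k).length + 1)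

/-- Two gaps that are connected within a slice. -/
inductive GapJoined : D.Gap → D.Gap → Prop
  | pass (k : Fin D.len) (g : Fin ((D.row k.castSucc).length + 1))
      (h : Fin ((D.row k.succ).length + 1)) (hgh : (D.slice k).GapPass g h) :
      GapJoined ⟨k.castSucc, g⟩ ⟨k.succ, h⟩

/-- The set of regions of the diagram. -/
def Region : Type := Quot D.GapJoined

/-- The region that contains a gap. -/
def region (g : D.Gap) : D.Region := Quot.mk _ g

/-- The unbounded region. -/
def unbounded : D.Region := D.region ⟨0, 0⟩

/-- The gap at a piece from which the normal vector of the piece points. The normal vector is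
the direction of the orientation rotated counterclockwise by a right angle, so it points to the
right for a string oriented downward. -/
def source (s : D.Piece) : D.Gap := ⟨s.1, if D.down s then s.2.castSucc else s.2.succ⟩

/-- The gap at a piece to which the normal vector of the piece points. -/
def target (s : D.Piece) : D.Gap := ⟨s.1, if D.down s then s.2.succ else s.2.castSucc⟩

/-- The set of crossings of the diagram: a slice that is a crossing, and its over-under
information. -/
def Crossing : Type := {c : Fin D.len × Bool // (D.slice c.1).kind = .cross c.2}

noncomputable instance : Fintype D.Crossing := by unfold Crossing; infer_instance

end LinkDiagram

/-! ### Crossings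

At a crossing with under-string `u` and over-string `o` there is a unique quadrant from which the
normal vectors of both strings point away; call it the specified quadrant. The ends
`i`, `k` are the two halves of `u` and the ends `j`, `l` the two halves of `o`, where `i` and `j`
are the ones that bound the specified quadrant. -/

/-- The data attached to the four ends of a crossing. -/
structure Ends (α : Type*) where
  i : α
  j : α
  k : α
  l : α

/-- Apply a map to the data at the four ends. -/
def Ends.map {α β : Type*} (f : α → β) (e : Ends α) : Ends β := ⟨f e.i, f e.j, f e.k, f e.l⟩

/-- The four ends of a crossing. The two strings are `NW-SE` and `NE-SW`; `leftOver` says that the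
string `NW-SE` is the over-string, and `ε`, `δ` say that `NW-SE`, `NE-SW` respectively are oriented
downward. -/
def crossingEnds {α : Type*} (leftOver ε δ : Bool) (nw ne sw se : α) : Ends α :=
  let nearA := if δ then nw else se
  let farA := if δ then se else nw
  let nearB := if ε then sw else ne
  let farB := if ε then ne else sw
  if leftOver then ⟨nearB, nearA, farB, farA⟩ else ⟨nearA, nearB, farA, farB⟩

/-- The specified quadrant of a crossing. -/
def specifiedQuadrant {α : Type*} (ε δ : Bool) (north south west east : α) : α :=
  if ε then (if δ then west else south) else (if δ then north else east)

/-- The sign of a crossing: `1` if the directions of the over-string and the under-string, in this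
order, form a positively oriented basis of the plane, and `-1` otherwise. -/
def crossingSign (leftOver ε δ : Bool) : ℤ :=
  if leftOver = (ε == δ) then -1 else 1

/-- The rule for the biquandle colors of the four ends of a crossing. -/
def ColorRule {X : Type u} [Biquandle X] (e : Ends X) : Prop :=
  underOp e.i e.j = e.k ∧ overOp e.j e.i = e.l

theorem crossingEnds_map {α β : Type*} (f : α → β) (leftOver ε δ : Bool) (nw ne sw se : α) :
    (crossingEnds leftOver ε δ nw ne sw se).map f =
      crossingEnds leftOver ε δ (f nw) (f ne) (f sw) (f se) := by
  cases leftOver <;> cases ε <;> cases δ <;> rfl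

/-- The colors of the four ends are compatible with the region colors. -/
theorem ColorRule.letters {X : Type u} [Biquandle X] {leftOver ε δ : Bool} {nw ne sw se : X}
    (h : ColorRule (crossingEnds leftOver ε δ nw ne sw se)) :
    (if ε then gen nw else (gen nw)⁻¹) * (if δ then gen ne else (gen ne)⁻¹) =
      (if δ then gen sw else (gen sw)⁻¹) * (if ε then gen se else (gen se)⁻¹) := by
  have key := gen_mul_gen (crossingEnds leftOver ε δ nw ne sw se).i
    (crossingEnds leftOver ε δ nw ne sw se).j
  rw [h.1, h.2] at key
  cases leftOver <;> cases ε <;> cases δ <;>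
    simp only [crossingEnds, if_true, if_false, Bool.false_eq_true] at key ⊢
  all_goals
    first
    | exact key
    | exact key.symm
    | rw [← mul_inv_rev, ← mul_inv_rev, key]
    | rw [inv_mul_eq_iff_eq_mul, ← mul_assoc, eq_mul_inv_iff_mul_eq, key]
    | rw [mul_inv_eq_iff_eq_mul, mul_assoc, eq_inv_mul_iff_mul_eq, key]

namespace LinkDiagram

variable (D : LinkDiagram)

theorem crossing_row (c : D.Crossing) :
    (D.slice c.1.1).pos + 1 < (D.row c.1.1.castSucc).length ∧
    (D.slice c.1.1).pos + 1 < (D.row c.1.1.succ).length := by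
  obtain ⟨l, r, hl, h⟩ := D.fits c.1.1
  rw [c.2] at h
  obtain ⟨ε, δ, h1, h2⟩ := h
  rw [h1, h2]
  simp only [List.length_append, List.length_cons, hl]
  omega

variable {D}

namespace Crossing

/-- The upper left end of a crossing. -/
def nw (c : D.Crossing) : D.Piece :=
  ⟨c.1.1.castSucc, (D.slice c.1.1).pos, by have := D.crossing_row c; omega⟩

/-- The upper right end of a crossing. -/
def ne (c : D.Crossing) : D.Piece :=
  ⟨c.1.1.castSucc, (D.slice c.1.1).pos + 1, by have := D.crossing_row c; omega⟩

/-- The lower left end of a crossing. -/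
def sw (c : D.Crossing) : D.Piece :=
  ⟨c.1.1.succ, (D.slice c.1.1).pos, by have := D.crossing_row c; omega⟩

/-- The lower right end of a crossing. -/
def se (c : D.Crossing) : D.Piece :=
  ⟨c.1.1.succ, (D.slice c.1.1).pos + 1, by have := D.crossing_row c; omega⟩

/-- The gap on the left of a crossing. -/
def west (c : D.Crossing) : D.Gap :=
  ⟨c.1.1.castSucc, (D.slice c.1.1).pos, by have := D.crossing_row c; omega⟩

/-- The gap on the right of a crossing. -/
def east (c : D.Crossing) : D.Gap :=
  ⟨c.1.1.castSucc, (D.slice c.1.1).pos + 2, by have := D.crossing_row c; omega⟩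

/-- The gap above a crossing. -/
def north (c : D.Crossing) : D.Gap :=
  ⟨c.1.1.castSucc, (D.slice c.1.1).pos + 1, by have := D.crossing_row c; omega⟩

/-- The gap below a crossing. -/
def south (c : D.Crossing) : D.Gap :=
  ⟨c.1.1.succ, (D.slice c.1.1).pos + 1, by have := D.crossing_row c; omega⟩

/-- The four semi-arcs around a crossing. -/
def ends (c : D.Crossing) : Ends D.SemiArc :=
  crossingEnds c.1.2 (D.down c.nw) (D.down c.ne)
    (D.semiArc c.nw) (D.semiArc c.ne) (D.semiArc c.sw) (D.semiArc c.se)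

/-- The specified region at a crossing. -/
def specified (c : D.Crossing) : D.Region :=
  D.region (specifiedQuadrant (D.down c.nw) (D.down c.ne) c.north c.south c.west c.east)

/-- The sign of a crossing. -/
def sign (c : D.Crossing) : ℤ := crossingSign c.1.2 (D.down c.nw) (D.down c.ne)

end Crossing

/-! ### Colorings -/

variable (D)

/-- The set of biquandle colorings of `D` by `X`. -/
def BiquandleColoring (X : Type u) [Biquandle X] : Type u :=
  {C : D.SemiArc → X // ∀ c : D.Crossing,
    ColorRule ((c.ends).map C)}

/-- The set of quandle colorings of `D` by `Q`. -/
def QuandleColoring (Q : Type u) [Quandle Q] : Type u :=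
  {C : D.Arc → Q // ∀ c : D.Crossing,
    Shelf.act (C (D.toArc c.ends.j)) (C (D.toArc c.ends.i)) = C (D.toArc c.ends.k)}

instance : Finite D.SemiArc := by unfold SemiArc; infer_instance

instance : Finite D.Arc := by unfold Arc; infer_instance

instance (X : Type u) [Biquandle X] [Finite X] : Finite (D.BiquandleColoring X) := by
  unfold BiquandleColoring; infer_instance

instance (Q : Type u) [Quandle Q] [Finite Q] : Finite (D.QuandleColoring Q) := by
  unfold QuandleColoring; infer_instance

variable {D}

theorem Crossing.toArc_l (c : D.Crossing) : D.toArc c.ends.l = D.toArc c.ends.j := by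
  have key : D.toArc c.ends.j = D.toArc c.ends.l ∨ D.toArc c.ends.l = D.toArc c.ends.j := by
    obtain ⟨⟨k, b⟩, hb⟩ := c
    cases b
    · have h : D.toArc (D.semiArc (Crossing.ne ⟨(k, false), hb⟩)) =
          D.toArc (D.semiArc (Crossing.sw ⟨(k, false), hb⟩)) :=
        Quot.sound (.rightOver k _ _ hb rfl rfl)
      cases hd : D.down (Crossing.nw ⟨(k, false), hb⟩) <;>
        simp [Crossing.ends, crossingEnds, hd, h]
    · have h : D.toArc (D.semiArc (Crossing.nw ⟨(k, true), hb⟩)) =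
          D.toArc (D.semiArc (Crossing.se ⟨(k, true), hb⟩)) :=
        Quot.sound (.leftOver k _ _ hb rfl rfl)
      cases hd : D.down (Crossing.ne ⟨(k, true), hb⟩) <;>
        simp [Crossing.ends, crossingEnds, hd, h]
  exact key.elim Eq.symm id

/-- A quandle coloring, considered as a biquandle coloring. -/
def QuandleColoring.toBiquandle {Q : Type u} [Quandle Q] (C : D.QuandleColoring Q) :
    D.BiquandleColoring Q :=
  ⟨fun σ => C.1 (D.toArc σ), fun c => ⟨C.2 c, (congrArg C.1 c.toArc_l).symm⟩⟩

/-! ### Region colorings -/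

/-- A region coloring with respect to a biquandle coloring. -/
structure IsRegionColoring {X : Type u} [Biquandle X] (C : D.BiquandleColoring X)
    (R : D.Region → As X) : Prop where
  unbounded : R D.unbounded = 1
  cross : ∀ s : D.Piece,
    R (D.region (D.source s)) * gen (C.1 (D.semiArc s)) = R (D.region (D.target s))

section RegionColoring

variable {X : Type u} [Biquandle X] (C : D.BiquandleColoring X)

theorem _root_.BiquandleLink.Slice.Fits.getElem?_pass {s : Slice} {t b : List Bool}
    (h : s.Fits t b) {i j : ℕ} (hij : s.StringPass i j) : t[i]? = b[j]? := by
  obtain ⟨l, r, hl, h⟩ := h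
  unfold Slice.StringPass at hij
  split at h
  · rename_i hk
    obtain ⟨ε, rfl, rfl⟩ := h
    simp only [hk] at hij
    rcases hij with ⟨h1, rfl⟩ | ⟨h1, rfl⟩
    · rw [List.getElem?_append_left (by omega), List.getElem?_append_left (by omega)]
    · rw [List.getElem?_append_right (by omega), List.getElem?_append_right (by omega),
        show i + 2 - l.length = (i - l.length) + 1 + 1 by omega]
      simp
  · rename_i hk
    obtain ⟨ε, rfl, rfl⟩ := h
    simp only [hk] at hij
    rcases hij with ⟨h1, rfl⟩ | ⟨h1, rfl⟩
    · rw [List.getElem?_append_left (by omega), List.getElem?_append_left (by omega)]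
    · rw [List.getElem?_append_right (by omega), List.getElem?_append_right (by omega),
        show j + 2 - l.length = (j - l.length) + 1 + 1 by omega]
      simp
  · rename_i hk
    obtain ⟨ε, δ, rfl, rfl⟩ := h
    simp only [hk] at hij
    obtain ⟨h1 | h1, rfl⟩ := hij
    · rw [List.getElem?_append_left (by omega), List.getElem?_append_left (by omega)]
    · rw [List.getElem?_append_right (by omega), List.getElem?_append_right (by omega)]
      obtain ⟨m, hm⟩ : ∃ m, j - l.length = m + 1 + 1 := ⟨j - l.length - 2, by omega⟩
      simp [hm]

/-- The factor by which the region color changes from left to right across string number `j`. -/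
def letter (k : Fin (D.len + 1)) (j : ℕ) : As X :=
  if h : j < (D.row k).length then
    if D.down ⟨k, ⟨j, h⟩⟩ then gen (C.1 (D.semiArc ⟨k, ⟨j, h⟩⟩))
    else (gen (C.1 (D.semiArc ⟨k, ⟨j, h⟩⟩)))⁻¹
  else 1

/-- The color of gap number `g`, read off along the row from the left. -/
def gapColor (k : Fin (D.len + 1)) : ℕ → As X
  | 0 => 1
  | g + 1 => gapColor k g * letter C k g

theorem letter_pass (k : Fin D.len) {i j : ℕ} (h : (D.slice k).StringPass i j) :
    letter C k.castSucc i = letter C k.succ j := by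
  have he := (D.fits k).getElem?_pass h
  unfold letter
  by_cases hi : i < (D.row k.castSucc).length
  · have hj : j < (D.row k.succ).length := by
      by_contra hj
      rw [List.getElem?_eq_getElem hi, List.getElem?_eq_none (by omega)] at he
      cases he
    rw [List.getElem?_eq_getElem hi, List.getElem?_eq_getElem hj] at he
    have hd : D.down ⟨k.castSucc, ⟨i, hi⟩⟩ = D.down ⟨k.succ, ⟨j, hj⟩⟩ := Option.some.inj he
    have hc : D.semiArc ⟨k.castSucc, ⟨i, hi⟩⟩ = D.semiArc ⟨k.succ, ⟨j, hj⟩⟩ :=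
      Quot.sound (.pass k _ _ h)
    rw [dif_pos hi, dif_pos hj, hd, hc]
  · have hj : ¬ j < (D.row k.succ).length := by
      intro hj
      rw [List.getElem?_eq_getElem hj, List.getElem?_eq_none (by omega)] at he
      cases he
    rw [dif_neg hi, dif_neg hj]

theorem letter_bend (k : Fin (D.len + 1)) {i : ℕ} {ε : Bool} (hi : i + 1 < (D.row k).length)
    (h0 : (D.row k)[i]? = some ε) (h1 : (D.row k)[i + 1]? = some (!ε))
    (hc : D.semiArc ⟨k, ⟨i, by omega⟩⟩ = D.semiArc ⟨k, ⟨i + 1, hi⟩⟩) :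
    letter C k i * letter C k (i + 1) = 1 := by
  rw [List.getElem?_eq_getElem (by omega)] at h0 h1
  have d0 : D.down ⟨k, ⟨i, by omega⟩⟩ = ε := Option.some.inj h0
  have d1 : D.down ⟨k, ⟨i + 1, hi⟩⟩ = !ε := Option.some.inj h1
  unfold letter
  rw [dif_pos hi, dif_pos (by omega), d0, d1, hc]
  cases ε <;> simp

theorem letter_cross (k : Fin D.len) {b : Bool} (hk : (D.slice k).kind = .cross b) :
    letter C k.castSucc (D.slice k).pos * letter C k.castSucc ((D.slice k).pos + 1) =
      letter C k.succ (D.slice k).pos * letter C k.succ ((D.slice k).pos + 1) := by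
  let c : D.Crossing := ⟨(k, b), hk⟩
  have hrow := D.crossing_row c
  have hC := C.2 c
  have hd : D.down c.nw = D.down c.se ∧ D.down c.ne = D.down c.sw := by
    obtain ⟨l, r, hl, h⟩ := D.fits k
    rw [hk] at h
    obtain ⟨ε, δ, h1, h2⟩ := h
    have e0 : (D.row k.castSucc)[(D.slice k).pos]? = some ε := by rw [h1, ← hl]; simp
    have e1 : (D.row k.castSucc)[(D.slice k).pos + 1]? = some δ := by rw [h1, ← hl]; simp
    have e2 : (D.row k.succ)[(D.slice k).pos]? = some δ := by rw [h2, ← hl]; simp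
    have e3 : (D.row k.succ)[(D.slice k).pos + 1]? = some ε := by rw [h2, ← hl]; simp
    obtain ⟨hr0, hr1⟩ := hrow
    have hr0' : (D.slice k).pos + 1 < (D.row k.castSucc).length := hr0
    have hr1' : (D.slice k).pos + 1 < (D.row k.succ).length := hr1
    rw [List.getElem?_eq_getElem (by omega)] at e0 e1 e2 e3
    exact ⟨(Option.some.inj e0).trans (Option.some.inj e3).symm,
      (Option.some.inj e1).trans (Option.some.inj e2).symm⟩
  have l0 : letter C k.castSucc (D.slice k).pos =
      if D.down c.nw then gen (C.1 (D.semiArc c.nw)) else (gen (C.1 (D.semiArc c.nw)))⁻¹ :=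
    dif_pos (Nat.lt_of_succ_lt hrow.1)
  have l1 : letter C k.castSucc ((D.slice k).pos + 1) =
      if D.down c.ne then gen (C.1 (D.semiArc c.ne)) else (gen (C.1 (D.semiArc c.ne)))⁻¹ :=
    dif_pos hrow.1
  have l2 : letter C k.succ (D.slice k).pos =
      if D.down c.sw then gen (C.1 (D.semiArc c.sw)) else (gen (C.1 (D.semiArc c.sw)))⁻¹ :=
    dif_pos (Nat.lt_of_succ_lt hrow.2)
  have l3 : letter C k.succ ((D.slice k).pos + 1) =
      if D.down c.se then gen (C.1 (D.semiArc c.se)) else (gen (C.1 (D.semiArc c.se)))⁻¹ :=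
    dif_pos hrow.2
  rw [l0, l1, l2, l3, ← hd.1, ← hd.2]
  rw [Crossing.ends, crossingEnds_map] at hC
  exact hC.letters

theorem gapColor_pass (k : Fin D.len) {g h : ℕ} (hgh : (D.slice k).GapPass g h) :
    gapColor C k.castSucc g = gapColor C k.succ h := by
  have left : ∀ g ≤ (D.slice k).pos, gapColor C k.castSucc g = gapColor C k.succ g := by
    intro g hg
    induction g with
    | zero => rfl
    | succ g ih =>
      rw [gapColor, gapColor, ih (by omega), letter_pass C k (i := g) (j := g)]
      unfold Slice.StringPass
      split <;> omega
  have hleft := left _ le_rfl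
  obtain ⟨l, r, hl, hf⟩ := D.fits k
  unfold Slice.GapPass at hgh
  split at hf
  · rename_i hk
    simp only [hk] at hgh
    obtain ⟨ε, -, hf⟩ := hf
    have hlen : (D.slice k).pos + 1 < (D.row k.succ).length := by
      rw [hf]; simp only [List.length_append, List.length_cons]; omega
    have hb := letter_bend C k.succ (i := (D.slice k).pos) (ε := ε) hlen
      (by rw [hf, ← hl]; simp) (by rw [hf, ← hl]; simp) (Quot.sound (.max k _ _ hk rfl rfl))
    have right : ∀ n, gapColor C k.castSucc ((D.slice k).pos + n) =
        gapColor C k.succ ((D.slice k).pos + n + 2) := by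
      intro n
      induction n with
      | zero =>
        show _ = gapColor C k.succ _ * _ * _
        rw [mul_assoc]
        simpa only [Nat.add_zero, hb, mul_one] using hleft
      | succ n ih =>
        show gapColor C _ ((D.slice k).pos + n) * letter C _ ((D.slice k).pos + n) =
          gapColor C _ ((D.slice k).pos + n + 2) * letter C _ ((D.slice k).pos + n + 2)
        rw [ih, letter_pass C k (i := (D.slice k).pos + n) (j := (D.slice k).pos + n + 2)]
        unfold Slice.StringPass
        rw [hk]
        exact Or.inr ⟨by omega, rfl⟩
    rcases hgh with ⟨h1, rfl⟩ | ⟨h1, rfl⟩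
    · exact left _ h1
    · obtain ⟨n, rfl⟩ := Nat.exists_eq_add_of_le h1
      exact right n
  · rename_i hk
    simp only [hk] at hgh
    obtain ⟨ε, hf, -⟩ := hf
    have hlen : (D.slice k).pos + 1 < (D.row k.castSucc).length := by
      rw [hf]; simp only [List.length_append, List.length_cons]; omega
    have hb := letter_bend C k.castSucc (i := (D.slice k).pos) (ε := ε) hlen
      (by rw [hf, ← hl]; simp) (by rw [hf, ← hl]; simp) (Quot.sound (.min k _ _ hk rfl rfl))
    have right : ∀ n, gapColor C k.castSucc ((D.slice k).pos + n + 2) =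
        gapColor C k.succ ((D.slice k).pos + n) := by
      intro n
      induction n with
      | zero =>
        show gapColor C k.castSucc _ * _ * _ = _
        rw [mul_assoc]
        simpa only [Nat.add_zero, hb, mul_one] using hleft
      | succ n ih =>
        show gapColor C _ ((D.slice k).pos + n + 2) * letter C _ ((D.slice k).pos + n + 2) =
          gapColor C _ ((D.slice k).pos + n) * letter C _ ((D.slice k).pos + n)
        rw [ih,
          letter_pass C k (i := (D.slice k).pos + n + 2) (j := (D.slice k).pos + n)]
        unfold Slice.StringPass
        rw [hk]
        exact Or.inr ⟨by omega, rfl⟩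
    rcases hgh with ⟨h1, rfl⟩ | ⟨h1, rfl⟩
    · exact left _ h1
    · obtain ⟨n, rfl⟩ := Nat.exists_eq_add_of_le h1
      exact right n
  · rename_i b hk
    simp only [hk] at hgh
    have hb := letter_cross C k hk
    have right : ∀ n, gapColor C k.castSucc ((D.slice k).pos + 2 + n) =
        gapColor C k.succ ((D.slice k).pos + 2 + n) := by
      intro n
      induction n with
      | zero =>
        show gapColor C k.castSucc _ * _ * _ = gapColor C k.succ _ * _ * _
        rw [mul_assoc, mul_assoc, hb, hleft]
      | succ n ih =>
        show gapColor C _ ((D.slice k).pos + 2 + n) * letter C _ ((D.slice k).pos + 2 + n) =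
          gapColor C _ ((D.slice k).pos + 2 + n) * letter C _ ((D.slice k).pos + 2 + n)
        rw [ih,
          letter_pass C k (i := (D.slice k).pos + 2 + n) (j := (D.slice k).pos + 2 + n)]
        unfold Slice.StringPass
        rw [hk]
        exact ⟨Or.inr (by omega), rfl⟩
    obtain ⟨h1, rfl⟩ := hgh
    rcases Nat.lt_or_ge (D.slice k).pos h with h2 | h2
    · obtain ⟨n, rfl⟩ := Nat.exists_eq_add_of_le (show (D.slice k).pos + 2 ≤ h by omega)
      exact right n
    · exact left _ h2

theorem gapColor_cross (s : D.Piece) :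
    gapColor C s.1 (D.source s).2 * gen (C.1 (D.semiArc s)) = gapColor C s.1 (D.target s).2 := by
  obtain ⟨k, i⟩ := s
  have hl : letter C k i = if D.down ⟨k, i⟩ then gen (C.1 (D.semiArc ⟨k, i⟩))
    else (gen (C.1 (D.semiArc ⟨k, i⟩)))⁻¹ := dif_pos i.2
  have hg : gapColor C k ((i : ℕ) + 1) = gapColor C k i * letter C k i := rfl
  rw [hl] at hg
  cases hd : D.down ⟨k, i⟩ <;> simp [source, target, hd] at hg ⊢ <;> simp [hg]

/-- Every biquandle coloring has exactly one region coloring. -/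
theorem existsUnique_regionColoring : ∃! R : D.Region → As X, IsRegionColoring C R := by
  refine ⟨Quot.lift (fun g => gapColor C g.1 g.2) ?_, ⟨rfl, fun s => gapColor_cross C s⟩, ?_⟩
  · rintro _ _ ⟨k, g, h, hgh⟩
    exact gapColor_pass C k hgh
  · intro R hR
    have h0 : ∀ k : Fin (D.len + 1), R (D.region ⟨k, 0⟩) = 1 := by
      intro k
      induction k using Fin.induction with
      | zero => exact hR.unbounded
      | succ k ih =>
        rw [← ih]
        refine congrArg R (Quot.sound (.pass k 0 0 ?_)).symm
        unfold Slice.GapPass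
        split <;> simp
    have h1 : ∀ (k : Fin (D.len + 1)) (g : ℕ) (hg : g < (D.row k).length + 1),
        R (D.region ⟨k, ⟨g, hg⟩⟩) = gapColor C k g := by
      intro k g
      induction g with
      | zero => exact fun _ => h0 k
      | succ g ih =>
        intro hg
        have hs := hR.cross ⟨k, ⟨g, by omega⟩⟩
        have ht := gapColor_cross C ⟨k, ⟨g, by omega⟩⟩
        have ih' := ih (by omega)
        unfold source target at hs ht
        cases hd : D.down ⟨k, ⟨g, by omega⟩⟩
        · simp only [hd, Bool.false_eq_true, if_false] at hs ht
          exact mul_right_cancel ((hs.trans ih').trans ht.symm)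
        · simp only [hd, if_true] at hs ht
          exact hs.symm.trans ((congrArg (· * _) ih').trans ht)
    funext r
    obtain ⟨⟨k, g⟩, rfl⟩ := Quot.exists_rep r
    exact h1 k g g.2

/-- The region coloring with respect to a biquandle coloring. -/
noncomputable def regionColoring : D.Region → As X := (existsUnique_regionColoring C).exists.choose

theorem regionColoring_spec : IsRegionColoring C (regionColoring C) :=
  (existsUnique_regionColoring C).exists.choose_spec

end RegionColoring

/-! ### Pulling away the doubled strings

Replace `D` by its double: behind every string a copy with the opposite orientation is put, pushed
slightly in the direction of the normal vector. In a row of vertical strings, first the copy of the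
leftmost string is moved to the far right, then the copy of the second string to the place on the
left of that one, and so on; the copies stay behind all other strings that they meet. This leaves
the original strings on the left and the copies, in reverse order, on the right. -/

/-- The coloring of the double of a row that is induced by a quandle coloring: a string and its
copy both get the color of the arc. -/
def doubledRow {X : Type u} [Biquandle X] (C : D.QuandleColoring (Qdl X)) (k : Fin (D.len + 1)) :
    List (Bool × X) :=
  (List.finRange (D.row k).length).flatMap fun i =>
    let s : D.Piece := ⟨k, i⟩
    let a : X := (C.1 (D.toArc (D.semiArc s))).val
    if D.down s then [(D.down s, a), (!D.down s, a)] else [(!D.down s, a), (D.down s, a)]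

/-- The colored row of strings of `D` given by a biquandle coloring. -/
def coloredRow {X : Type u} [Biquandle X] (C : D.BiquandleColoring X) (k : Fin (D.len + 1)) :
    List (Bool × X) :=
  List.ofFn fun i : Fin (D.row k).length => (D.down ⟨k, i⟩, C.1 (D.semiArc ⟨k, i⟩))

/-- The positions, from top to bottom, of the crossings that pull away the copies from the double
of a row with orientations `ε`. In step `j`, the copy of string number `j` starts at position
`j + 1` or `j` and ends at position `2 * n - 1 - j`, where `n` is the number of strings. -/
def pullAwayWord (ε : List Bool) : List ℕ :=
  (List.finRange ε.length).flatMap fun (j : Fin ε.length) =>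
    let start : ℕ := (j : ℕ) + if ε.get j then 1 else 0
    List.range' start (2 * ε.length - 1 - (j : ℕ) - start)

/-- `BraidColoring w t b`: the tangle without maxima and minima that has its crossings at the
positions `w`, at each of which the string from the upper left to the lower right goes under, has a
biquandle coloring with the oriented and colored row `t` at the top and `b` at the bottom. -/
inductive BraidColoring {X : Type u} [Biquandle X] :
    List ℕ → List (Bool × X) → List (Bool × X) → Prop
  | nil (t : List (Bool × X)) : BraidColoring [] t t
  | cons (l r : List (Bool × X)) (ε δ : Bool) (nw ne sw se : X) (w : List ℕ)
      (b : List (Bool × X)) (rule : ColorRule (crossingEnds false ε δ nw ne sw se))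
      (h : BraidColoring w (l ++ (δ, sw) :: (ε, se) :: r) b) :
      BraidColoring (l.length :: w) (l ++ (ε, nw) :: (δ, ne) :: r) b

/-- `IsPullAway C C'`: the biquandle coloring `C'` is what is left on the strings of `D` when the
double of `D`, with the coloring induced by `C`, has its copies pulled away. -/
def IsPullAway {X : Type u} [Biquandle X] (C : D.QuandleColoring (Qdl X))
    (C' : D.BiquandleColoring X) : Prop :=
  ∀ k : Fin (D.len + 1), ∃ copies : List (Bool × X),
    BraidColoring (pullAwayWord (D.row k)) (doubledRow C k) (coloredRow C' k ++ copies)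

/-! ### Cocycle invariants -/

section Invariants

variable {A : Type v} [AddCommGroup A]

/-- The weight of a crossing for a biquandle coloring: the sign times `θ (x, y)`, where `x` and `y`
are the colors of the halves of the under-string and the over-string that bound the specified
region. -/
def Crossing.biquandleWeight {X : Type u} [Biquandle X] (θ : X × X → A)
    (C : D.BiquandleColoring X) (c : D.Crossing) : A :=
  c.sign • θ (C.1 c.ends.i, C.1 c.ends.j)

/-- The weight of a crossing for a quandle coloring: the sign times `θ (p, a, b)`, where `p` is the
color of the specified region, and `a` and `b` are the colors of the arcs of the under-string and
the over-string that bound this region. -/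
noncomputable def Crossing.shadowWeight {Q : Type u} [Quandle Q] (θ : As Q × Q × Q → A)
    (C : D.QuandleColoring Q) (c : D.Crossing) : A :=
  c.sign • θ (regionColoring C.toBiquandle c.specified,
    C.1 (D.toArc c.ends.i), C.1 (D.toArc c.ends.j))

variable (D)

/-- The biquandle cocycle invariant, as a map on the set of colorings. -/
noncomputable def biquandleInvariant {X : Type u} [Biquandle X] (θ : X × X → A)
    (C : D.BiquandleColoring X) : A :=
  ∑ c : D.Crossing, c.biquandleWeight θ C

/-- The shadow quandle cocycle invariant, as a map on the set of colorings. -/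
noncomputable def shadowInvariant {Q : Type u} [Quandle Q] (θ : As Q × Q × Q → A)
    (C : D.QuandleColoring Q) : A :=
  ∑ c : D.Crossing, c.shadowWeight θ C

/-- The biquandle cocycle invariant in the group ring `ℤ[A]`, for a finite biquandle (then there
are only finitely many colorings). -/
noncomputable def biquandleInvariantSum {X : Type u} [Biquandle X] [Finite X] (θ : X × X → A) :
    AddMonoidAlgebra ℤ A :=
  ∑ᶠ C : D.BiquandleColoring X, AddMonoidAlgebra.single (D.biquandleInvariant θ C) 1

/-- The shadow quandle cocycle invariant in the group ring `ℤ[A]`, for a finite quandle. -/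
noncomputable def shadowInvariantSum {Q : Type u} [Quandle Q] [Finite Q]
    (θ : As Q × Q × Q → A) : AddMonoidAlgebra ℤ A :=
  ∑ᶠ C : D.QuandleColoring Q, AddMonoidAlgebra.single (D.shadowInvariant θ C) 1

end Invariants

end LinkDiagram

end BiquandleLink

open BiquandleLink

/-!
For every `p` in `As(Q(X))` the map `psi p` is a bijection from `Q(X)` to `X`, so that each `x` in
`X` permutes `As(Q(X))` by `p ↦ p * gen a`, where `psi p a = x`. The relations between the `psi p`
say precisely that these permutations satisfy the relations of `As(X)`: the set `As(Q(X))` is a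
right `As(X)`-set. Given an `X`-coloring of a diagram, the regions can therefore be colored by
`As(Q(X))` in exactly one way with `1` on the unbounded region.

A `Q(X)`-coloring `C` with region coloring `R` gives the `X`-coloring in which a semi-arc `σ` has
the color `psi (R r) (C σ)`, where `r` is the region from which the normal vector of `σ` points, and
then `R` is the coloring of the regions just described. So `R`, and with it `C`, can be recovered
from the `X`-coloring. As `σᵢ` and `σⱼ` both have the specified region as that region `r`, the two
weights of a crossing agree.

Pulling the copies away yields the same `X`-coloring: a row of doubled strings to the right of a gap
with region color `p` has the colors `psi p a`, and the copy of its first string, on the way to the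
far right, changes `p` to the color of the next gap.
-/

namespace BiquandleLink

universe u v

open Biquandle

/-! ### The right `As(X)`-set `As(Q(X))` -/

section Psi

variable {X : Type u} [Biquandle X]

theorem overInv_kMap (x : X) : overInv x (kMap x) = kMap x :=
  over_right_cancel ((over_overInv _ _).trans (over_kMap _).symm)

theorem psi_act (p : As (Qdl X)) (a b : Qdl X) :
    psi p (Shelf.act b a) = derived (psi p a) (psi p b) :=
  ((psiHom p).unop ⟨id, fun _ _ => rfl⟩).2 a.val b.val

theorem psi_mul_gen_act (p : As (Qdl X)) (a b : Qdl X) :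
    psi (p * gen b) (Shelf.act b a) = underOp (psi p a) (psi p b) := by
  rw [psi_mul_gen, psi_act, over_derived]

theorem psi_mul_gen_inv_self (p : As (Qdl X)) (a : Qdl X) :
    psi (p * (gen a)⁻¹) a = kMap (psi p a) := by
  rw [psi_mul_gen_inv, overInv_kMap]

theorem isShadowCocycle_pullback {A : Type v} [AddCommGroup A] {θ : X × X → A}
    (hθ : IsBiquandleCocycle θ) : IsShadowCocycle (pullback θ) where
  cocycle p a₁ a₂ a₃ := by
    simp only [pullback, psi_mul_gen, psi_act, derived_over, over_derived]
    exact hθ.cocycle _ _ _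
  degenerate p b := hθ.degenerate _

theorem As.closure_range_gen : Subgroup.closure (Set.range (gen : X → As X)) = ⊤ :=
  PresentedGroup.closure_range_of _

theorem psi_bijective (p : As (Qdl X)) : Bijective (psi p) := by
  have hp : p ∈ Subgroup.closure (Set.range (gen : Qdl X → As (Qdl X))) :=
    (As.closure_range_gen (X := Qdl X)).symm ▸ Subgroup.mem_top p
  induction hp using Subgroup.closure_induction_right with
  | one =>
    rw [show psi (1 : As (Qdl X)) = Qdl.val from funext psi_one]
    exact ⟨fun _ _ => Qdl.ext, fun x => ⟨⟨x⟩, rfl⟩⟩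
  | mul_right p _ g hg ih =>
    obtain ⟨b, rfl⟩ := hg
    rw [show psi (p * gen b) = overPerm (psi p b) ∘ psi p from
      funext fun a => psi_mul_gen p a b]
    exact (overPerm _).bijective.comp ih
  | mul_inv_cancel p _ g hg ih =>
    obtain ⟨b, rfl⟩ := hg
    rw [show psi (p * (gen b)⁻¹) = (overPerm (kMap (psi p b))).symm ∘ psi p from
      funext fun a => psi_mul_gen_inv p a b]
    exact (overPerm _).symm.bijective.comp ih

/-- The bijection `psi p` between the quandle `Q(X)` and the biquandle `X`. -/
noncomputable def psiEquiv (p : As (Qdl X)) : Qdl X ≃ X := Equiv.ofBijective _ (psi_bijective p)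

theorem psi_psiEquiv_symm (p : As (Qdl X)) (x : X) : psi p ((psiEquiv p).symm x) = x :=
  (psiEquiv p).apply_symm_apply x

theorem psiEquiv_symm_psi (p : As (Qdl X)) (a : Qdl X) : (psiEquiv p).symm (psi p a) = a :=
  (psiEquiv p).symm_apply_apply a

/-- The permutation of `As(Q(X))` by which `x` acts from the right: it sends `p` to `p * gen a`,
where `psi p a = x`. -/
noncomputable def asPerm (x : X) : Equiv.Perm (As (Qdl X)) where
  toFun p := p * gen ((psiEquiv p).symm x)
  invFun q := q * (gen ((psiEquiv q).symm (overOp x x)))⁻¹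
  left_inv p := by
    obtain ⟨a, rfl⟩ := (psi_bijective p).surjective x
    simp only [psiEquiv_symm_psi, ← psi_mul_gen, mul_inv_cancel_right]
  right_inv q := by
    obtain ⟨a, ha⟩ := (psi_bijective q).surjective (overOp x x)
    obtain rfl : psi (q * (gen a)⁻¹) a = x := by rw [psi_mul_gen_inv_self, ha, kMap_over]
    simp only [← ha, psiEquiv_symm_psi, inv_mul_cancel_right]

theorem asPerm_apply (x : X) (p : As (Qdl X)) :
    asPerm x p = p * gen ((psiEquiv p).symm x) := rfl

theorem asPerm_psi (p : As (Qdl X)) (a : Qdl X) : asPerm (psi p a) p = p * gen a := by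
  rw [asPerm_apply, psiEquiv_symm_psi]

theorem asPerm_asPerm (x y : X) (p : As (Qdl X)) :
    asPerm (overOp y x) (asPerm x p) = asPerm (underOp x y) (asPerm y p) := by
  obtain ⟨a, rfl⟩ := (psi_bijective p).surjective x
  obtain ⟨b, rfl⟩ := (psi_bijective p).surjective y
  have relation : gen a * gen b = gen b * gen (Shelf.act b a) := gen_mul_gen a b
  rw [asPerm_psi, asPerm_psi, ← psi_mul_gen, ← psi_mul_gen_act, asPerm_psi, asPerm_psi,
    mul_assoc, mul_assoc, relation]

/-- The homomorphism from the associated group induced by a map that respects its relations. -/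
def As.lift {G : Type*} [Group G] (f : X → G)
    (hf : ∀ x y, f x * f (overOp y x) = f y * f (underOp x y)) : As X →* G :=
  PresentedGroup.toGroup (f := f) (by
    rintro _ ⟨x, y, rfl⟩
    simpa only [map_mul, map_inv, FreeGroup.lift_apply_of, mul_inv_eq_one] using hf x y)

theorem As.lift_gen {G : Type*} [Group G] (f : X → G)
    (hf : ∀ x y, f x * f (overOp y x) = f y * f (underOp x y)) (x : X) :
    As.lift f hf (gen x) = f x :=
  PresentedGroup.toGroup.of _

/-- The right action of `As(X)` on the set `As(Q(X))`. -/
noncomputable def asAction : As X →* (Equiv.Perm (As (Qdl X)))ᵐᵒᵖ :=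
  As.lift (fun x => MulOpposite.op (asPerm x)) fun x y =>
    MulOpposite.unop_injective (Equiv.ext (asPerm_asPerm x y))

/-- The orbit map of the unit element under `asAction`. -/
noncomputable def asOrbit (g : As X) : As (Qdl X) := (asAction g).unop 1

theorem asOrbit_one : asOrbit (1 : As X) = 1 := by
  rw [asOrbit, map_one asAction]
  rfl

theorem asOrbit_mul_gen (g : As X) (x : X) : asOrbit (g * gen x) = asPerm x (asOrbit g) := by
  rw [asOrbit, map_mul, MulOpposite.unop_mul, Equiv.Perm.mul_apply, asAction, As.lift_gen]
  rfl

end Psi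

/-! ### The regions on the two sides of a semi-arc -/

namespace Slice

variable {s : Slice} {t b : List Bool}

theorem StringPass.gapPass {i j : ℕ} (h : s.StringPass i j) :
    s.GapPass i j ∧ s.GapPass (i + 1) (j + 1) := by
  unfold StringPass at h
  unfold GapPass
  cases hk : s.kind <;> simp only [hk] at h ⊢ <;> omega

theorem Fits.getElem?_max (h : s.Fits t b) (hk : s.kind = .max) :
    b[s.pos + 1]? = b[s.pos]?.map (!·) ∧ s.pos ≤ t.length := by
  obtain ⟨l, r, hl, h⟩ := h
  rw [hk] at h
  obtain ⟨ε, rfl, rfl⟩ := h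
  simp [← hl]

theorem Fits.getElem?_min (h : s.Fits t b) (hk : s.kind = .min) :
    t[s.pos + 1]? = t[s.pos]?.map (!·) ∧ s.pos ≤ b.length := by
  obtain ⟨l, r, hl, h⟩ := h
  rw [hk] at h
  obtain ⟨ε, rfl, rfl⟩ := h
  simp [← hl]

theorem Fits.getElem?_cross {leftOver : Bool} (h : s.Fits t b) (hk : s.kind = .cross leftOver) :
    t[s.pos]? = b[s.pos + 1]? ∧ t[s.pos + 1]? = b[s.pos]? := by
  obtain ⟨l, r, hl, h⟩ := h
  rw [hk] at h
  obtain ⟨ε, δ, rfl, rfl⟩ := h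
  simp [← hl]

end Slice

namespace LinkDiagram

variable {D : LinkDiagram}

/-- The region on the left of a piece, whatever its orientation. -/
def leftRegion (s : D.Piece) : D.Region := D.region ⟨s.1, s.2.castSucc⟩

/-- The region on the right of a piece, whatever its orientation. -/
def rightRegion (s : D.Piece) : D.Region := D.region ⟨s.1, s.2.succ⟩

theorem region_source (s : D.Piece) :
    D.region (D.source s) = if D.down s then leftRegion s else rightRegion s := by
  unfold source
  split <;> rfl

theorem region_target (s : D.Piece) :
    D.region (D.target s) = if D.down s then rightRegion s else leftRegion s := by
  unfold target
  split <;> rfl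

theorem region_eq_of_gapPass (k : Fin D.len) {g : Fin ((D.row k.castSucc).length + 1)}
    {h : Fin ((D.row k.succ).length + 1)} (hgh : (D.slice k).GapPass g h) :
    D.region ⟨k.castSucc, g⟩ = D.region ⟨k.succ, h⟩ :=
  Quot.sound (.pass k g h hgh)

theorem region_zero (k : Fin (D.len + 1)) : D.region ⟨k, 0⟩ = D.unbounded := by
  induction k using Fin.induction with
  | zero => rfl
  | succ k ih =>
    rw [← ih]
    refine (region_eq_of_gapPass k ?_).symm
    unfold Slice.GapPass
    split <;> simp

theorem region_induction {P : D.Region → Prop} (unbounded : P D.unbounded)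
    (right : ∀ s : D.Piece, P (leftRegion s) → P (rightRegion s)) (r : D.Region) : P r := by
  obtain ⟨⟨k, g⟩, rfl⟩ := Quot.exists_rep r
  change P (D.region ⟨k, g⟩)
  induction g using Fin.induction with
  | zero => rwa [region_zero]
  | succ g ih => exact right ⟨k, g⟩ ih

theorem getElem?_row (s : D.Piece) : (D.row s.1)[(s.2 : ℕ)]? = some (D.down s) :=
  List.getElem?_eq_getElem s.2.2

theorem down_congr {s t : D.Piece} (h : (D.row s.1)[(s.2 : ℕ)]? = (D.row t.1)[(t.2 : ℕ)]?) :
    D.down s = D.down t :=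
  Option.some.inj (by rw [← getElem?_row, h, getElem?_row])

theorem down_eq_not {s t : D.Piece}
    (h : (D.row t.1)[(t.2 : ℕ)]? = (D.row s.1)[(s.2 : ℕ)]?.map (!·)) :
    D.down t = !D.down s :=
  Option.some.inj (by rw [← getElem?_row, h, getElem?_row, Option.map_some])

theorem source_target_of_parallel {s t : D.Piece} (hd : D.down s = D.down t)
    (left : leftRegion s = leftRegion t) (right : rightRegion s = rightRegion t) :
    D.region (D.source s) = D.region (D.source t) ∧
      D.region (D.target s) = D.region (D.target t) := by
  simp only [region_source, region_target, hd, left, right, and_self]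

theorem source_target_of_antiparallel {s t : D.Piece} (hd : D.down t = !D.down s)
    (inner : rightRegion s = leftRegion t) (outer : leftRegion s = rightRegion t) :
    D.region (D.source s) = D.region (D.source t) ∧
      D.region (D.target s) = D.region (D.target t) := by
  simp only [region_source, region_target, hd, inner, outer]
  cases D.down s <;> exact ⟨rfl, rfl⟩

theorem rightRegion_eq_leftRegion {k : Fin (D.len + 1)} {i j : Fin (D.row k).length}
    (hij : (j : ℕ) = i + 1) : rightRegion ⟨k, i⟩ = leftRegion (D := D) ⟨k, j⟩ :=
  congrArg (fun g => D.region ⟨k, g⟩) (Fin.ext hij.symm)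

theorem Joined.source_target {s t : D.Piece} (h : D.Joined s t) :
    D.region (D.source s) = D.region (D.source t) ∧
      D.region (D.target s) = D.region (D.target t) := by
  cases h with
  | pass k i j h =>
    exact source_target_of_parallel (down_congr ((D.fits k).getElem?_pass h))
      (region_eq_of_gapPass k h.gapPass.1) (region_eq_of_gapPass k h.gapPass.2)
  | max k i j hk hi hj =>
    obtain ⟨hd, hlen⟩ := (D.fits k).getElem?_max hk
    let above : Fin ((D.row k.castSucc).length + 1) := ⟨(D.slice k).pos, by omega⟩
    have left : D.region ⟨k.castSucc, above⟩ = leftRegion ⟨k.succ, i⟩ :=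
      region_eq_of_gapPass k (by simp [Slice.GapPass, hk, hi, above])
    have right : D.region ⟨k.castSucc, above⟩ = rightRegion ⟨k.succ, j⟩ :=
      region_eq_of_gapPass k (by simp [Slice.GapPass, hk, hj, above])
    exact source_target_of_antiparallel (down_eq_not (by rw [hi, hj, hd]))
      (rightRegion_eq_leftRegion (by omega)) (left.symm.trans right)
  | min k i j hk hi hj =>
    obtain ⟨hd, hlen⟩ := (D.fits k).getElem?_min hk
    let below : Fin ((D.row k.succ).length + 1) := ⟨(D.slice k).pos, by omega⟩
    have left : leftRegion ⟨k.castSucc, i⟩ = D.region ⟨k.succ, below⟩ :=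
      region_eq_of_gapPass k (by simp [Slice.GapPass, hk, hi, below])
    have right : rightRegion ⟨k.castSucc, j⟩ = D.region ⟨k.succ, below⟩ :=
      region_eq_of_gapPass k (by simp [Slice.GapPass, hk, hj, below])
    exact source_target_of_antiparallel (down_eq_not (by rw [hi, hj, hd]))
      (rightRegion_eq_leftRegion (by omega)) (left.trans right.symm)

/-- The region from which the normal vector of a semi-arc points. -/
def sourceRegion : D.SemiArc → D.Region :=
  Quot.lift (fun s => D.region (D.source s)) fun _ _ h => h.source_target.1

/-- The region to which the normal vector of a semi-arc points. -/
def targetRegion : D.SemiArc → D.Region :=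
  Quot.lift (fun s => D.region (D.target s)) fun _ _ h => h.source_target.2

theorem sourceRegion_semiArc (s : D.Piece) :
    sourceRegion (D.semiArc s) = if D.down s then leftRegion s else rightRegion s :=
  region_source s

theorem targetRegion_semiArc (s : D.Piece) :
    targetRegion (D.semiArc s) = if D.down s then rightRegion s else leftRegion s :=
  region_target s

theorem region_funext {S : Type*} (step : D.SemiArc → Equiv.Perm S) {R R' : D.Region → S}
    (unbounded : R D.unbounded = R' D.unbounded)
    (h : ∀ σ, R (targetRegion σ) = step σ (R (sourceRegion σ)))
    (h' : ∀ σ, R' (targetRegion σ) = step σ (R' (sourceRegion σ))) : R = R' := by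
  funext r
  refine region_induction (P := fun r => R r = R' r) unbounded (fun s left => ?_) r
  have hs := h (D.semiArc s)
  have hs' := h' (D.semiArc s)
  rw [sourceRegion_semiArc, targetRegion_semiArc] at hs hs'
  cases hd : D.down s <;> simp only [hd, if_true, if_false, Bool.false_eq_true] at hs hs'
  · exact (step _).injective (by rw [← hs, ← hs', left])
  · rw [hs, hs', left]

namespace Crossing

variable (c : D.Crossing)

theorem down_sw : D.down c.sw = D.down c.ne :=
  (down_congr ((D.fits c.1.1).getElem?_cross c.2).2).symm

theorem down_se : D.down c.se = D.down c.nw :=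
  (down_congr ((D.fits c.1.1).getElem?_cross c.2).1).symm

theorem leftRegion_sw : leftRegion c.sw = D.region c.west :=
  (region_eq_of_gapPass c.1.1 (by simp [Slice.GapPass, c.2, sw])).symm

theorem rightRegion_se : rightRegion c.se = D.region c.east :=
  (region_eq_of_gapPass c.1.1 (by simp [Slice.GapPass, c.2, se])).symm

theorem sourceRegion_nw : sourceRegion (D.semiArc c.nw) =
    if D.down c.nw then D.region c.west else D.region c.north :=
  sourceRegion_semiArc c.nw

theorem targetRegion_nw : targetRegion (D.semiArc c.nw) =
    if D.down c.nw then D.region c.north else D.region c.west :=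
  targetRegion_semiArc c.nw

theorem sourceRegion_ne : sourceRegion (D.semiArc c.ne) =
    if D.down c.ne then D.region c.north else D.region c.east :=
  sourceRegion_semiArc c.ne

theorem targetRegion_ne : targetRegion (D.semiArc c.ne) =
    if D.down c.ne then D.region c.east else D.region c.north :=
  targetRegion_semiArc c.ne

theorem sourceRegion_sw : sourceRegion (D.semiArc c.sw) =
    if D.down c.ne then D.region c.west else D.region c.south := by
  rw [sourceRegion_semiArc, leftRegion_sw, down_sw]
  rfl

theorem targetRegion_sw : targetRegion (D.semiArc c.sw) =
    if D.down c.ne then D.region c.south else D.region c.west := by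
  rw [targetRegion_semiArc, leftRegion_sw, down_sw]
  rfl

theorem sourceRegion_se : sourceRegion (D.semiArc c.se) =
    if D.down c.nw then D.region c.south else D.region c.east := by
  rw [sourceRegion_semiArc, rightRegion_se, down_se]
  rfl

theorem targetRegion_se : targetRegion (D.semiArc c.se) =
    if D.down c.nw then D.region c.east else D.region c.south := by
  rw [targetRegion_semiArc, rightRegion_se, down_se]
  rfl

theorem regions :
    sourceRegion c.ends.i = c.specified ∧ sourceRegion c.ends.j = c.specified ∧
      sourceRegion c.ends.k = targetRegion c.ends.j ∧
      sourceRegion c.ends.l = targetRegion c.ends.i := by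
  unfold ends specified
  rcases c.1.2 <;> cases hε : D.down c.nw <;> cases hδ : D.down c.ne <;>
    simp [crossingEnds, specifiedQuadrant, sourceRegion_nw, targetRegion_nw, sourceRegion_ne,
      targetRegion_ne, sourceRegion_sw, targetRegion_sw, sourceRegion_se, targetRegion_se, hε, hδ]

end Crossing

theorem OverJoined.eq_of_ends {Z : Type*} {f : D.SemiArc → Z}
    (hf : ∀ c : D.Crossing, f c.ends.l = f c.ends.j) {s t : D.Piece} (h : D.OverJoined s t) :
    f (D.semiArc s) = f (D.semiArc t) := by
  cases h with
  | joined h => exact congrArg f (Quot.sound h)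
  | leftOver k i j h hi hj =>
    let c : D.Crossing := ⟨(k, true), h⟩
    obtain rfl : i = c.nw.2 := Fin.ext hi
    obtain rfl : j = c.se.2 := Fin.ext hj
    have hc := hf c
    unfold Crossing.ends crossingEnds at hc
    cases hδ : D.down c.ne <;> simp only [hδ, c, if_true, if_false, Bool.false_eq_true] at hc
    exacts [hc, hc.symm]
  | rightOver k i j h hi hj =>
    let c : D.Crossing := ⟨(k, false), h⟩
    obtain rfl : i = c.ne.2 := Fin.ext hi
    obtain rfl : j = c.sw.2 := Fin.ext hj
    have hc := hf c
    unfold Crossing.ends crossingEnds at hc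
    cases hε : D.down c.nw <;> simp only [hε, c, if_true, if_false, Bool.false_eq_true] at hc
    exacts [hc.symm, hc]

end LinkDiagram

/-! ### The bijection between the colorings -/

section RegionColoring

variable {Y : Type u} [Biquandle Y]

/-- The factor by which a region coloring changes, from left to right, at a vertical string with
color `y`, which is oriented downward for `ε = true` and upward for `ε = false`. -/
def signedGen (ε : Bool) (y : Y) : As Y := if ε then gen y else (gen y)⁻¹

namespace LinkDiagram

variable {D : LinkDiagram} {C : D.BiquandleColoring Y} {R : D.Region → As Y}

theorem IsRegionColoring.semiArc (h : IsRegionColoring C R) (σ : D.SemiArc) :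
    R (sourceRegion σ) * gen (C.1 σ) = R (targetRegion σ) := by
  obtain ⟨s, rfl⟩ := Quot.exists_rep σ
  exact h.cross s

theorem IsRegionColoring.rightRegion (h : IsRegionColoring C R) (s : D.Piece) :
    R (rightRegion s) = R (leftRegion s) * signedGen (D.down s) (C.1 (D.semiArc s)) := by
  have hs := h.semiArc (D.semiArc s)
  rw [sourceRegion_semiArc, targetRegion_semiArc] at hs
  unfold signedGen
  cases hd : D.down s <;> simp only [hd, if_true, if_false, Bool.false_eq_true] at hs ⊢
  · exact eq_mul_inv_of_mul_eq hs
  · exact hs.symm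

end LinkDiagram

end RegionColoring

namespace LinkDiagram

variable {D : LinkDiagram} {X : Type u} [Biquandle X]

section PsiColoring

variable (C : D.QuandleColoring (Qdl X))

theorem colorRule_psi {R : D.Region → As (Qdl X)} (hR : IsRegionColoring C.toBiquandle R)
    (c : D.Crossing) :
    ColorRule (c.ends.map fun σ => psi (R (sourceRegion σ)) (C.1 (D.toArc σ))) := by
  obtain ⟨hi, hj, hk, hl⟩ := c.regions
  have color_k : C.1 (D.toArc c.ends.k) = Shelf.act (C.1 (D.toArc c.ends.j))
      (C.1 (D.toArc c.ends.i)) := (C.2 c).symm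
  have region_k : R (sourceRegion c.ends.k) = R c.specified * gen (C.1 (D.toArc c.ends.j)) := by
    rw [hk, ← hR.semiArc, hj]
    rfl
  have region_l : R (sourceRegion c.ends.l) = R c.specified * gen (C.1 (D.toArc c.ends.i)) := by
    rw [hl, ← hR.semiArc, hi]
    rfl
  simp only [ColorRule, Ends.map, hi, hj, region_k, region_l, color_k, c.toArc_l]
  exact ⟨(psi_mul_gen_act _ _ _).symm, (psi_mul_gen _ _ _).symm⟩

/-- The coloring by `X` in which a semi-arc has the color `psi p a`, where `a` is the color of its
arc in a coloring by `Q(X)` and `p` is the color of the region from which its normal vector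
points. -/
noncomputable def psiColoring : D.BiquandleColoring X :=
  ⟨fun σ => psi (regionColoring C.toBiquandle (sourceRegion σ)) (C.1 (D.toArc σ)),
    colorRule_psi C (regionColoring_spec _)⟩

theorem psiColoring_apply (σ : D.SemiArc) : (psiColoring C).1 σ =
    psi (regionColoring C.toBiquandle (sourceRegion σ)) (C.1 (D.toArc σ)) := rfl

theorem asOrbit_regionColoring_psiColoring (r : D.Region) :
    asOrbit (regionColoring (psiColoring C) r) = regionColoring C.toBiquandle r := by
  have hX := regionColoring_spec (psiColoring C)
  have hQ := regionColoring_spec C.toBiquandle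
  refine congrFun (region_funext (R := fun r => asOrbit (regionColoring (psiColoring C) r))
    (fun σ => asPerm ((psiColoring C).1 σ)) ?_ (fun σ => ?_) fun σ => ?_) r
  · rw [hX.unbounded, hQ.unbounded, asOrbit_one]
  · rw [← hX.semiArc, asOrbit_mul_gen]
  · rw [psiColoring_apply, asPerm_psi, ← hQ.semiArc]
    rfl

end PsiColoring

section PsiInvColoring

variable (C : D.BiquandleColoring X)

/-- The color in `Q(X)` of a semi-arc, in the coloring that is the inverse image of `C` under
`psiColoring`. -/
noncomputable def psiInvColor (σ : D.SemiArc) : Qdl X :=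
  (psiEquiv (asOrbit (regionColoring C (sourceRegion σ)))).symm (C.1 σ)

theorem psi_psiInvColor (σ : D.SemiArc) :
    psi (asOrbit (regionColoring C (sourceRegion σ))) (psiInvColor C σ) = C.1 σ :=
  psi_psiEquiv_symm _ _

theorem asOrbit_targetRegion (σ : D.SemiArc) :
    asOrbit (regionColoring C (targetRegion σ)) =
      asOrbit (regionColoring C (sourceRegion σ)) * gen (psiInvColor C σ) := by
  rw [← (regionColoring_spec C).semiArc, asOrbit_mul_gen, asPerm_apply, psiInvColor]

theorem psiInvColor_l (c : D.Crossing) : psiInvColor C c.ends.l = psiInvColor C c.ends.j := by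
  obtain ⟨hi, hj, -, hl⟩ := c.regions
  have rule : overOp (C.1 c.ends.j) (C.1 c.ends.i) = C.1 c.ends.l := (C.2 c).2
  apply (psi_bijective (asOrbit (regionColoring C (sourceRegion c.ends.l)))).injective
  rw [psi_psiInvColor, hl, asOrbit_targetRegion, psi_mul_gen, psi_psiInvColor, hi, ← hj,
    psi_psiInvColor, rule]

theorem psiInvColor_k (c : D.Crossing) :
    psiInvColor C c.ends.k = Shelf.act (psiInvColor C c.ends.j) (psiInvColor C c.ends.i) := by
  obtain ⟨hi, hj, hk, -⟩ := c.regions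
  have rule : underOp (C.1 c.ends.i) (C.1 c.ends.j) = C.1 c.ends.k := (C.2 c).1
  apply (psi_bijective (asOrbit (regionColoring C (sourceRegion c.ends.k)))).injective
  rw [psi_psiInvColor, hk, asOrbit_targetRegion, psi_mul_gen_act, psi_psiInvColor, hj, ← hi,
    psi_psiInvColor, rule]

/-- `psiInvColor` as a map on the arcs. -/
noncomputable def psiInvArcColor : D.Arc → Qdl X :=
  Quot.lift (fun s => psiInvColor C (D.semiArc s)) fun _ _ h => h.eq_of_ends (psiInvColor_l C)

theorem psiInvArcColor_toArc (σ : D.SemiArc) :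
    psiInvArcColor C (D.toArc σ) = psiInvColor C σ := by
  obtain ⟨s, rfl⟩ := Quot.exists_rep σ
  rfl

/-- The coloring by `Q(X)` that is the inverse image of `C` under `psiColoring`. -/
noncomputable def psiInvColoring : D.QuandleColoring (Qdl X) :=
  ⟨psiInvArcColor C, fun c => by simp only [psiInvArcColor_toArc, psiInvColor_k]⟩

theorem psiInvColoring_toArc (σ : D.SemiArc) :
    (psiInvColoring C).1 (D.toArc σ) = psiInvColor C σ :=
  psiInvArcColor_toArc C σ

theorem regionColoring_psiInvColoring :
    regionColoring (psiInvColoring C).toBiquandle = fun r => asOrbit (regionColoring C r) := by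
  refine (existsUnique_regionColoring _).unique (regionColoring_spec _) ⟨?_, fun s => ?_⟩
  · rw [(regionColoring_spec C).unbounded, asOrbit_one]
  · exact (asOrbit_targetRegion C (D.semiArc s)).symm

theorem psiColoring_psiInvColoring : psiColoring (psiInvColoring C) = C := by
  refine Subtype.ext (funext fun σ => ?_)
  rw [psiColoring_apply, regionColoring_psiInvColoring, psiInvColoring_toArc, psi_psiInvColor]

end PsiInvColoring

theorem psiInvColoring_psiColoring (C : D.QuandleColoring (Qdl X)) :
    psiInvColoring (psiColoring C) = C := by
  refine Subtype.ext (funext fun α => ?_)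
  obtain ⟨s, rfl⟩ := Quot.exists_rep α
  change (psiInvColoring (psiColoring C)).1 (D.toArc (D.semiArc s)) = C.1 (D.toArc (D.semiArc s))
  rw [psiInvColoring_toArc, psiInvColor, asOrbit_regionColoring_psiColoring, psiColoring_apply,
    psiEquiv_symm_psi]

variable (D X) in
/-- The bijection between the colorings by `Q(X)` and the colorings by `X`. -/
noncomputable def coloringEquiv : D.QuandleColoring (Qdl X) ≃ D.BiquandleColoring X where
  toFun := psiColoring
  invFun := psiInvColoring
  left_inv := psiInvColoring_psiColoring
  right_inv := psiColoring_psiInvColoring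

section Invariants

variable {A : Type v} [AddCommGroup A] (θ : X × X → A)

theorem biquandleWeight_psiColoring (C : D.QuandleColoring (Qdl X)) (c : D.Crossing) :
    c.biquandleWeight θ (psiColoring C) = c.shadowWeight (pullback θ) C := by
  obtain ⟨hi, hj, -, -⟩ := c.regions
  rw [Crossing.biquandleWeight, psiColoring_apply, psiColoring_apply, hi, hj]
  rfl

theorem biquandleInvariant_psiColoring (C : D.QuandleColoring (Qdl X)) :
    D.biquandleInvariant θ (psiColoring C) = D.shadowInvariant (pullback θ) C :=
  Finset.sum_congr rfl fun c _ => biquandleWeight_psiColoring θ C c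

variable (D) in
theorem biquandleInvariantSum_eq_shadowInvariantSum [Finite X] :
    D.biquandleInvariantSum θ = D.shadowInvariantSum (pullback θ) :=
  (finsum_eq_of_bijective psiColoring (D.coloringEquiv X).bijective fun C => by
    rw [biquandleInvariant_psiColoring]).symm

end Invariants

end LinkDiagram

/-! ### Pulling away the copies -/

section PullAway

variable {X : Type u} [Biquandle X]

theorem switch_injective {x y x' y' : X} (hOver : overOp y x = overOp y' x')
    (hUnder : underOp x y = underOp x' y') : x = x' ∧ y = y' :=
  Prod.mk.inj (switch_bijective.injective (Prod.ext hOver hUnder :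
    (overOp y x, underOp x y) = (overOp y' x', underOp x' y')))

theorem ColorRule.bottom_unique {ε δ : Bool} {nw ne sw se sw' se' : X}
    (h : ColorRule (crossingEnds false ε δ nw ne sw se))
    (h' : ColorRule (crossingEnds false ε δ nw ne sw' se')) : sw = sw' ∧ se = se' := by
  obtain ⟨hUnder, hOver⟩ := h
  obtain ⟨hUnder', hOver'⟩ := h'
  cases ε <;> cases δ <;>
    simp only [crossingEnds, if_true, if_false, Bool.false_eq_true] at hUnder hOver hUnder' hOver'
  · obtain rfl := (under_bijective ne).injective (hUnder.trans hUnder'.symm)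
    exact ⟨hOver.symm.trans hOver', rfl⟩
  · exact ⟨hOver.symm.trans hOver', hUnder.symm.trans hUnder'⟩
  · exact (switch_injective (hOver.trans hOver'.symm) (hUnder.trans hUnder'.symm)).symm
  · obtain rfl := over_right_cancel (hOver.trans hOver'.symm)
    exact ⟨rfl, hUnder.symm.trans hUnder'⟩

namespace LinkDiagram.BraidColoring

theorem cons_inv {m : ℕ} {w : List ℕ} {t b : List (Bool × X)} (h : BraidColoring (m :: w) t b) :
    ∃ (l r : List (Bool × X)) (ε δ : Bool) (nw ne sw se : X), l.length = m ∧
      t = l ++ (ε, nw) :: (δ, ne) :: r ∧ ColorRule (crossingEnds false ε δ nw ne sw se) ∧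
      BraidColoring w (l ++ (δ, sw) :: (ε, se) :: r) b := by
  cases h with
  | cons l r ε δ nw ne sw se w b rule h =>
    exact ⟨l, r, ε, δ, nw, ne, sw, se, rfl, rfl, rule, h⟩

theorem bottom_unique {w : List ℕ} {t b b' : List (Bool × X)} (h : BraidColoring w t b)
    (h' : BraidColoring w t b') : b = b' := by
  induction h with
  | nil t => cases h'; rfl
  | cons l r ε δ nw ne sw se w b rule _ ih =>
    obtain ⟨l', r', ε', δ', nw', ne', sw', se', hl, ht, rule', h'⟩ := h'.cons_inv
    obtain ⟨rfl, ht'⟩ := List.append_inj ht hl.symm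
    simp only [List.cons.injEq, Prod.mk.injEq] at ht'
    obtain ⟨⟨rfl, rfl⟩, ⟨rfl, rfl⟩, rfl⟩ := ht'
    obtain ⟨rfl, rfl⟩ := rule.bottom_unique rule'
    exact ih h'

theorem append {w w' : List ℕ} {t m b : List (Bool × X)} (h : BraidColoring w t m)
    (h' : BraidColoring w' m b) : BraidColoring (w ++ w') t b := by
  induction h with
  | nil t => exact h'
  | cons l r ε δ nw ne sw se w b rule _ ih => exact cons l r ε δ nw ne sw se _ _ rule (ih h')

end LinkDiagram.BraidColoring

open LinkDiagram

/-- The row of doubled strings with colors `c`. The normal vector of a string points to its left or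
to its right according to its orientation, so in every string-copy pair it is the downward one that
is on the left. -/
def pairRow {Y : Type*} (c : List Y) : List (Bool × Y) := c.flatMap fun y => [(true, y), (false, y)]

theorem pairRow_cons {Y : Type*} (y : Y) (c : List Y) :
    pairRow (y :: c) = (true, y) :: (false, y) :: pairRow c := rfl

/-- The effect on the colors of the other strings when a string with color `x` passes behind them to
the right; that string is oriented upward for `ε = true`, as it is the copy of a string of
orientation `ε`. -/
noncomputable def signedOver (ε : Bool) (x : X) : Equiv.Perm X :=
  if ε then overPerm x else (overPerm x)⁻¹

/-- The color, after its copy has been pulled away, of a string of orientation `ε` that starts with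
the color `x`. -/
noncomputable def strandColor (ε : Bool) (x : X) : X := if ε then x else kMap x

theorem exists_colorRule_pair (ε : Bool) (x y : X) : ∃ z,
    ColorRule (crossingEnds false (!ε) true x y (signedOver ε x y) z) ∧
      ColorRule (crossingEnds false (!ε) false z y (signedOver ε x y) x) := by
  cases ε
  · have h : overOp (signedOver false x y) x = y := over_overInv y x
    exact ⟨underOp x (signedOver false x y), ⟨rfl, h⟩, rfl, h⟩
  · exact ⟨underOp x y, ⟨rfl, rfl⟩, rfl, rfl⟩

theorem braidColoring_behind (ε : Bool) (x : X) (c : List X) (l r : List (Bool × X)) :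
    BraidColoring (List.range' l.length (2 * c.length)) (l ++ (!ε, x) :: (pairRow c ++ r))
      (l ++ (pairRow (c.map (signedOver ε x)) ++ (!ε, x) :: r)) := by
  induction c generalizing l with
  | nil => exact .nil _
  | cons y c ih =>
    let y' := signedOver ε x y
    obtain ⟨z, first, second⟩ := exists_colorRule_pair ε x y
    rw [List.length_cons, mul_add_one, List.range'_succ, List.range'_succ, pairRow_cons]
    refine .cons l ((false, y) :: (pairRow c ++ r)) (!ε) true x y y' z _ _ first ?_
    have rest := BraidColoring.cons (l ++ [(true, y')]) (pairRow c ++ r) (!ε) false z y y' x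
      (List.range' (l.length + 1 + 1) (2 * c.length))
      (l ++ (pairRow ((y :: c).map (signedOver ε x)) ++ (!ε, x) :: r)) second
      (by simpa [pairRow_cons, y'] using ih (l ++ [(true, y'), (false, y')]))
    simpa using rest

theorem braidColoring_pullCopy (ε : Bool) (x : X) (c : List X) (l r : List (Bool × X)) :
    BraidColoring
      (List.range' (l.length + if ε then 1 else 0) (2 * c.length + if ε then 0 else 1))
      (l ++ (pairRow (x :: c) ++ r))
      (l ++ (ε, strandColor ε x) :: (pairRow (c.map (signedOver ε (strandColor ε x))) ++
        (!ε, strandColor ε x) :: r)) := by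
  have behind := braidColoring_behind ε (strandColor ε x) c (l ++ [(ε, strandColor ε x)]) r
  cases ε
  · have own : ColorRule (crossingEnds false true false x x (kMap x) (kMap x)) :=
      ⟨(under_self _).trans (over_kMap x), over_kMap x⟩
    refine .cons l (pairRow c ++ r) true false x x (kMap x) (kMap x) _ _ own ?_
    simpa [strandColor] using behind
  · simpa [strandColor, pairRow_cons] using behind

/-- The positions of the crossings that pull away the copies of strings with orientations `w`, if
there are `m` strings on their left. -/
def pullAwayWordFrom : ℕ → List Bool → List ℕ
  | _, [] => []
  | m, ε :: w =>
    List.range' (m + if ε then 1 else 0) (2 * w.length + if ε then 0 else 1) ++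
      pullAwayWordFrom (m + 1) w

theorem pullAwayWordFrom_eq_flatMap (m : ℕ) (w : List Bool) :
    pullAwayWordFrom m w = (List.finRange w.length).flatMap fun j =>
      List.range' (m + j + if w.get j then 1 else 0)
        (2 * (m + w.length) - 1 - (m + j) - (m + j + if w.get j then 1 else 0)) := by
  induction w generalizing m with
  | nil => rfl
  | cons ε w ih =>
    rw [pullAwayWordFrom, ih]
    change _ = (List.finRange (w.length + 1)).flatMap _
    rw [List.finRange_succ, List.flatMap_cons, List.flatMap_map]
    congr 1
    · simp only [List.get_eq_getElem, Fin.val_zero, List.getElem_cons_zero, List.length_cons]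
      congr 1
      cases ε <;> simp only [if_true, if_false, Bool.false_eq_true] <;> omega
    · congr 1
      funext j
      simp only [List.get_eq_getElem, Fin.val_succ, List.getElem_cons_succ, List.length_cons]
      congr 1 <;> omega

theorem pullAwayWord_eq (w : List Bool) : pullAwayWord w = pullAwayWordFrom 0 w := by
  simp [pullAwayWord, pullAwayWordFrom_eq_flatMap]

theorem psi_mul_signedGen (p : As (Qdl X)) (ε : Bool) (a b : Qdl X) :
    psi (p * signedGen ε a) b = signedOver ε (strandColor ε (psi p a)) (psi p b) := by
  cases ε
  · exact psi_mul_gen_inv p b a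
  · exact psi_mul_gen p b a

/-- The row that is left after pulling away the copies of strings with given orientations and
quandle colors, if the region on their left has the color `p`. -/
noncomputable def pulledRow : As (Qdl X) → List (Bool × Qdl X) → List (Bool × X)
  | _, [] => []
  | p, (ε, a) :: w => (ε, strandColor ε (psi p a)) :: pulledRow (p * signedGen ε a) w

theorem braidColoring_pulledRow (p : As (Qdl X)) (w : List (Bool × Qdl X))
    (l r : List (Bool × X)) : ∃ copies : List (Bool × X),
    BraidColoring (pullAwayWordFrom l.length (w.map Prod.fst))
      (l ++ (pairRow (w.map fun s => psi p s.2) ++ r)) (l ++ (pulledRow p w ++ copies)) := by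
  induction w generalizing p l r with
  | nil => exact ⟨r, .nil _⟩
  | cons s w ih =>
    obtain ⟨ε, a⟩ := s
    let y := strandColor ε (psi p a)
    have first := braidColoring_pullCopy ε (psi p a) (w.map fun s => psi p s.2) l r
    have colors : (w.map fun s => psi p s.2).map (signedOver ε y) =
        w.map fun s => psi (p * signedGen ε a) s.2 := by
      simp only [List.map_map, comp_def, psi_mul_signedGen, y]
    obtain ⟨copies, rest⟩ := ih (p * signedGen ε a) (l ++ [(ε, y)]) ((!ε, y) :: r)
    refine ⟨copies, .append (by simpa [colors, y] using first) (by simpa [y, pulledRow] using rest)⟩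

theorem pulledRow_ofFn {n : ℕ} (s : Fin n → Bool × Qdl X) (P : Fin (n + 1) → As (Qdl X))
    (hP : ∀ i, P i.succ = P i.castSucc * signedGen (s i).1 (s i).2) :
    pulledRow (P 0) (List.ofFn s) =
      List.ofFn fun i => ((s i).1, strandColor (s i).1 (psi (P i.castSucc) (s i).2)) := by
  induction n with
  | zero => rfl
  | succ n ih =>
    have h0 : P 1 = P 0 * signedGen (s 0).1 (s 0).2 := hP 0
    have tail := ih (fun i => s i.succ) (fun i => P i.succ) fun i => hP i.succ
    rw [List.ofFn_succ, List.ofFn_succ, pulledRow, ← h0]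
    exact congrArg _ tail

namespace LinkDiagram

variable {D : LinkDiagram} (C : D.QuandleColoring (Qdl X))

theorem psiColoring_semiArc (s : D.Piece) : (psiColoring C).1 (D.semiArc s) =
    strandColor (D.down s)
      (psi (regionColoring C.toBiquandle (leftRegion s)) (C.1 (D.toArc (D.semiArc s)))) := by
  rw [psiColoring_apply, sourceRegion_semiArc]
  cases hd : D.down s
  · have right := (regionColoring_spec C.toBiquandle).rightRegion s
    rw [hd] at right
    rw [if_neg Bool.false_ne_true, right]
    exact psi_mul_gen_inv_self _ _
  · rfl

/-- The row of strings with their orientations and quandle colors. -/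
def quandleRow (k : Fin (D.len + 1)) : List (Bool × Qdl X) :=
  List.ofFn fun i : Fin (D.row k).length => (D.down ⟨k, i⟩, C.1 (D.toArc (D.semiArc ⟨k, i⟩)))

theorem map_fst_quandleRow (k : Fin (D.len + 1)) : (quandleRow C k).map Prod.fst = D.row k := by
  rw [quandleRow, List.map_ofFn]
  exact List.ofFn_getElem

theorem doubledRow_eq_pairRow (k : Fin (D.len + 1)) :
    doubledRow C k = pairRow ((quandleRow C k).map fun s => psi 1 s.2) := by
  simp only [doubledRow, pairRow, quandleRow, psi_one, List.ofFn_eq_map, List.flatMap_map,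
    List.map_map]
  congr 1
  funext i
  cases D.down ⟨k, i⟩ <;> rfl

theorem coloredRow_psiColoring (k : Fin (D.len + 1)) :
    coloredRow (psiColoring C) k = pulledRow 1 (quandleRow C k) := by
  have hR := regionColoring_spec C.toBiquandle
  have pulled := pulledRow_ofFn
    (fun i : Fin (D.row k).length => (D.down ⟨k, i⟩, C.1 (D.toArc (D.semiArc ⟨k, i⟩))))
    (fun g => regionColoring C.toBiquandle (D.region ⟨k, g⟩)) fun i => hR.rightRegion ⟨k, i⟩
  rw [region_zero, hR.unbounded] at pulled
  simp only [coloredRow, psiColoring_semiArc]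
  exact pulled.symm

theorem isPullAway_psiColoring : IsPullAway C (psiColoring C) := by
  intro k
  obtain ⟨copies, h⟩ := braidColoring_pulledRow 1 (quandleRow C k) [] []
  refine ⟨copies, ?_⟩
  rw [pullAwayWord_eq, coloredRow_psiColoring, doubledRow_eq_pairRow]
  simpa only [List.length_nil, map_fst_quandleRow, List.nil_append, List.append_nil] using h

theorem isPullAway_iff (C' : D.BiquandleColoring X) : IsPullAway C C' ↔ C' = psiColoring C := by
  refine ⟨fun h => Subtype.ext (funext fun σ => ?_), fun h => h ▸ isPullAway_psiColoring C⟩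
  obtain ⟨⟨k, i⟩, rfl⟩ := Quot.exists_rep σ
  obtain ⟨copies, h⟩ := h k
  obtain ⟨copies', h'⟩ := isPullAway_psiColoring C k
  have rows := (List.append_inj (h.bottom_unique h') (by simp [coloredRow])).1
  exact congrArg Prod.snd (congrFun (List.ofFn_injective rows) i)

end LinkDiagram

end PullAway

end BiquandleLink

theorem theorem5p1 {X : Type*} [Biquandle X] {A : Type*} [AddCommGroup A]
    (θ : X × X → A) (hθ : IsBiquandleCocycle θ) :
    IsShadowCocycle (pullback θ) ∧
    ∀ D : LinkDiagram, ∃ Ψ : D.QuandleColoring (Qdl X) ≃ D.BiquandleColoring X,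
      (∀ (C : D.QuandleColoring (Qdl X)) (C' : D.BiquandleColoring X),
        LinkDiagram.IsPullAway C C' ↔ C' = Ψ C) ∧
      (∀ (C : D.QuandleColoring (Qdl X)) (c : D.Crossing),
        c.biquandleWeight θ (Ψ C) = c.shadowWeight (pullback θ) C) ∧
      (∀ C : D.QuandleColoring (Qdl X),
        D.biquandleInvariant θ (Ψ C) = D.shadowInvariant (pullback θ) C) ∧
      (∀ _ : Finite X,
        D.biquandleInvariantSum θ = D.shadowInvariantSum (pullback θ)) :=
  ⟨isShadowCocycle_pullback hθ, fun D => ⟨D.coloringEquiv X,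
    LinkDiagram.isPullAway_iff,
    LinkDiagram.biquandleWeight_psiColoring θ,
    LinkDiagram.biquandleInvariant_psiColoring θ,
    fun _ => D.biquandleInvariantSum_eq_shadowInvariantSum θ⟩⟩
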